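/- Let $n\ge 1$ be an integer, $0<\alpha<n$, $\sigma\in(0,1]$ and $Q>0$. Write $|A|$ for the Lebesgue measure of $A\subseteq\mathbb R^n$, $B(x,r)$ for the Euclidean ball with centre $x$ and radius $r$, $B_1=B(0,1)$, and $$I_\alpha f(x)=\int_{\mathbb R^n}|x-y|^{\alpha-n}f(y)\,dy .$$ For measurable $F\subseteq\mathbb R^n$ let $L^{n/\alpha}(F)$ be the space of real-valued $f\in L^{n/\alpha}(\mathbb R^n)$ that vanish a.e. outside $F$. There exists a constant $C=C(n,\alpha,\sigma,Q)$ with the following property. Let $\nu$ be a positive Borel measure on $\mathbb R^n$ satisfying $$\nu(B(x,r))\le Q\,r^{\sigma n}\qquad\text{for all }x\in\mathbb R^n,\ r>0,$$ and let $E,F\subseteq\mathbb R^n$ be measurable (with respect to $\nu$ and to Lebesgue measure, respectively) with $\nu(E)<\infty$ and $|F|<\infty$. Then for all $f\in L^{n/\alpha}(F)$ with $\|f\|_{n/\alpha}\le 1$, the integral defining $I_\alpha f(x)$ converges absolutely for $\nu$-a.e. $x\in E$, and $$\int_E\exp\Big[\frac{\sigma}{|B_1|}\,|I_\alpha f(x)|^{\frac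 n{n-\alpha}}\Big]\,d\nu(x)\le C\big(\nu(E)+|F|^\sigma\big).$$ Moreover, if for such $\nu$, $E$, $F$ there are a ball $B(x_0,r_0)$, $r_0>0$, and a constant $c_1>0$ such that $|B(x_0,r_0)\cap F|=|B(x_0,r_0)|$ and $\nu(B(x_0,r)\cap E)\ge c_1 r^{\sigma n}$ for all $0<r\le r_0$, then the exponential constant $\sigma/|B_1|$ is sharp for this $E$ and $F$: for every $\gamma>\sigma/|B_1|$, $$\sup\Big\{\int_E\exp\big[\gamma\,|I_\alpha f(x)|^{\frac n{n-\alpha}}\big]\,d\nu(x)\;:\; f\in L^{n/\alpha}(F),\ \|f\|_{n/\alpha}\le 1\Big\}=+\infty .$$ -/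

import Mathlib

open MeasureTheory
open scoped ENNReal

/-- The (unnormalized) Riesz potential `I_α f = |x|^(α-n) * f` on `ℝⁿ`,
`I_α f(x) = ∫ |x-y|^(α-n) f(y) dy`. -/
noncomputable def rieszPotential {n : ℕ} (α : ℝ) (f : EuclideanSpace ℝ (Fin n) → ℝ)
    (x : EuclideanSpace ℝ (Fin n)) : ℝ :=
  ∫ y, ‖x - y‖ ^ (α - (n : ℝ)) * f y

/-- The integral defining `I_α f(x)` converges absolutely, so `I_α f(x)` is well defined
and finite. -/
def RieszPotentialConvergesAt {n : ℕ} (α : ℝ) (f : EuclideanSpace ℝ (Fin n) → ℝ)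
    (x : EuclideanSpace ℝ (Fin n)) : Prop :=
  Integrable (fun y => ‖x - y‖ ^ (α - (n : ℝ)) * f y) volume

/-- The closed unit ball of `L^p(F)`: functions in `L^p(ℝⁿ)`, zero almost everywhere
outside `F`, with `‖f‖_p ≤ 1`. -/
def InUnitBallLp {n : ℕ} (p : ℝ) (F : Set (EuclideanSpace ℝ (Fin n)))
    (f : EuclideanSpace ℝ (Fin n) → ℝ) : Prop :=
  MemLp f (ENNReal.ofReal p) volume ∧ (∀ᵐ y, y ∉ F → f y = 0) ∧
    eLpNorm f (ENNReal.ofReal p) volume ≤ 1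

/-- The Adams functional `∫_E exp[γ |I_α f(x)|^(n/(n-α))] dν(x)`, with values in `[0,∞]`. -/
noncomputable def adamsIntegral {n : ℕ} (α γ : ℝ) (ν : Measure (EuclideanSpace ℝ (Fin n)))
    (E : Set (EuclideanSpace ℝ (Fin n))) (f : EuclideanSpace ℝ (Fin n) → ℝ) : ℝ≥0∞ :=
  ∫⁻ x in E, ENNReal.ofReal
    (Real.exp (γ * |rieszPotential α f x| ^ ((n : ℝ) / ((n : ℝ) - α)))) ∂ν

/-- The volume `|B₁|` of the unit ball of `ℝⁿ`. -/
noncomputable def unitBallVolume (n : ℕ) : ℝ :=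
  (volume (Metric.ball (0 : EuclideanSpace ℝ (Fin n)) 1)).toReal

/-- Hölder's inequality for two summands, with an additional weight on the second one. -/
theorem two_term_holder {p q : ℝ} (hpq : p.HolderConjugate q) {u a b η : ℝ} (hu0 : 0 ≤ u)
    (hu1 : u ≤ 1) (ha : 0 ≤ a) (hb : 0 ≤ b) (hη : 0 < η) :
    ((1 - u) ^ (1 / p) * a ^ (1 / q) + u ^ (1 / p) * b ^ (1 / q)) ^ q ≤
      (1 - u + η * u) ^ (q - 1) * (a + η ^ (-(q - 1)) * b) := by
  have hp := hpq.pos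
  have hq := hpq.symm.pos
  have h1u : 0 ≤ 1 - u := by linarith
  have hηu : 0 ≤ η * u := by positivity
  have hηb : 0 ≤ η ^ (-(q - 1)) * b := by positivity
  have e : (q - 1) / q = 1 / p := by
    have := hpq.inv_add_inv_eq_one
    field_simp at this ⊢
    linarith
  have e2 : q / p = q - 1 := by
    have := hpq.inv_add_inv_eq_one
    field_simp at this ⊢
    linarith
  have key := Real.inner_le_Lp_mul_Lq_of_nonneg Finset.univ hpq
    (f := ![(1 - u) ^ (1 / p), (η * u) ^ (1 / p)])
    (g := ![a ^ (1 / q), (η ^ (-(q - 1)) * b) ^ (1 / q)])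
    (by intro i _; fin_cases i <;> simp <;> positivity)
    (by intro i _; fin_cases i <;> simp <;> positivity)
  simp only [Fin.sum_univ_two, Matrix.cons_val_zero, Matrix.cons_val_one] at key
  rw [← Real.rpow_mul h1u, ← Real.rpow_mul hηu, ← Real.rpow_mul ha, ← Real.rpow_mul hηb,
    one_div_mul_cancel hp.ne', one_div_mul_cancel hq.ne', Real.rpow_one, Real.rpow_one,
    Real.rpow_one, Real.rpow_one] at key
  have e3 : (η * u) ^ (1 / p) * (η ^ (-(q - 1)) * b) ^ (1 / q) = u ^ (1 / p) * b ^ (1 / q) := by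
    rw [Real.mul_rpow hη.le hu0, Real.mul_rpow (by positivity) hb, ← Real.rpow_mul hη.le]
    have : η ^ (1 / p) * η ^ (-(q - 1) * (1 / q)) = 1 := by
      rw [← Real.rpow_add hη]
      have : 1 / p + -(q - 1) * (1 / q) = 0 := by rw [← e]; ring
      rw [this, Real.rpow_zero]
    calc _ = (η ^ (1 / p) * η ^ (-(q - 1) * (1 / q))) * (u ^ (1 / p) * b ^ (1 / q)) := by ring
      _ = _ := by rw [this, one_mul]
  rw [e3] at key
  have h0 : 0 ≤ (1 - u) ^ (1 / p) * a ^ (1 / q) + u ^ (1 / p) * b ^ (1 / q) := by positivity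
  have h2 : 0 ≤ 1 - u + η * u := by positivity
  have h3 : 0 ≤ a + η ^ (-(q - 1)) * b := by positivity
  calc _ ≤ ((1 - u + η * u) ^ (1 / p) * (a + η ^ (-(q - 1)) * b) ^ (1 / q)) ^ q :=
        Real.rpow_le_rpow h0 key hq.le
    _ = _ := by
        rw [Real.mul_rpow (by positivity) (by positivity), ← Real.rpow_mul h2, ← Real.rpow_mul h3,
          one_div_mul_cancel hq.ne', Real.rpow_one, one_div_mul_eq_div, e2]

theorem one_sub_half_rpow_le {e u : ℝ} (he : 0 < e) (hu0 : 0 ≤ u) (hu1 : u ≤ 1) :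
    (1 - u / 2) ^ e ≤ 1 - min 1 e / 2 * u := by
  rcases le_total 1 e with h | h
  · rw [min_eq_left h]
    calc (1 - u / 2) ^ e ≤ (1 - u / 2) ^ (1 : ℝ) :=
          Real.rpow_le_rpow_of_exponent_ge (by linarith) (by linarith) h
      _ = _ := by rw [Real.rpow_one]; ring
  · rw [min_eq_right h]
    have := rpow_one_add_le_one_add_mul_self (s := -(u / 2)) (by linarith) he.le h
    calc (1 - u / 2) ^ e = (1 + -(u / 2)) ^ e := by ring_nf
      _ ≤ _ := this
      _ = _ := by ring

theorem one_add_mul_rpow_le {e L u : ℝ} (he : 0 < e) (hL : 0 ≤ L) (hu0 : 0 ≤ u) (hu1 : u ≤ 1) :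
    (1 + L * u) ^ e ≤ 1 + e * L * Real.exp (e * L) * u := by
  set x := e * L * u with hx
  have hx0 : 0 ≤ x := by positivity
  have h1 : (1 + L * u) ^ e ≤ Real.exp x := by
    calc (1 + L * u) ^ e ≤ (Real.exp (L * u)) ^ e :=
          Real.rpow_le_rpow (by positivity) (by linarith [Real.add_one_le_exp (L * u)]) he.le
      _ = Real.exp x := by rw [← Real.exp_mul]; congr 1; rw [hx]; ring
  have h2 : Real.exp x ≤ 1 + x * Real.exp x := by
    have h3 := Real.add_one_le_exp (-x)
    have h4 : Real.exp (-x) * Real.exp x = 1 := by rw [← Real.exp_add]; simp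
    nlinarith [Real.exp_pos x]
  have h5 : Real.exp x ≤ Real.exp (e * L) := by
    apply Real.exp_le_exp.2
    rw [hx]
    exact mul_le_of_le_one_right (by positivity) hu1
  calc _ ≤ 1 + x * Real.exp x := h1.trans h2
    _ ≤ 1 + x * Real.exp (e * L) := by gcongr
    _ = _ := by rw [hx]; ring

theorem exists_finset_of_gap (P : ℕ → Prop) (n₁ : ℕ) {w : ℝ} (hw0 : 0 ≤ w)
    (gap : ∀ j k : ℕ, n₁ ≤ j → j ≤ k → P j → P k → (k : ℝ) ≤ j + w) :
    ∃ T : Finset ℕ, (∀ k, P k → k ∈ T) ∧ (T.card : ℝ) ≤ n₁ + w + 1 := by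
  classical
  by_cases hex : ∃ j, n₁ ≤ j ∧ P j
  · have hj := Nat.find_spec hex
    have hjmin := fun k => Nat.find_min' (m := k) hex
    set j := Nat.find hex
    refine ⟨Finset.range n₁ ∪ Finset.Icc j (j + ⌊w⌋₊), ?_, ?_⟩
    · intro k hk
      rw [Finset.mem_union, Finset.mem_range, Finset.mem_Icc]
      rcases lt_or_ge k n₁ with h | h
      · exact Or.inl h
      · right
        have hjk := hjmin k ⟨h, hk⟩
        refine ⟨hjk, ?_⟩
        have h1 := gap j k hj.1 hjk hj.2 hk
        have h2 : k - j ≤ ⌊w⌋₊ := by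
          apply Nat.le_floor
          rw [Nat.cast_sub hjk]
          linarith
        omega
    · have h1 : ((Finset.range n₁ ∪ Finset.Icc j (j + ⌊w⌋₊)).card : ℝ) ≤ n₁ + (⌊w⌋₊ + 1) := by
        have := Finset.card_union_le (Finset.range n₁) (Finset.Icc j (j + ⌊w⌋₊))
        rw [Finset.card_range, Nat.card_Icc] at this
        have h2 : (Finset.range n₁ ∪ Finset.Icc j (j + ⌊w⌋₊)).card ≤ n₁ + (⌊w⌋₊ + 1) := by omega
        exact_mod_cast h2
      have h2 := Nat.floor_le hw0
      linarith
  · refine ⟨Finset.range n₁, ?_, ?_⟩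
    · intro k hk
      rw [Finset.mem_range]
      by_contra h
      exact hex ⟨k, not_lt.1 h, hk⟩
    · rw [Finset.card_range]
      linarith

set_option maxHeartbeats 400000 in
/-- A discrete form of the Adams–Garsia lemma: the number of indices at which the bound
`g k ^ q ≤ k` is nearly attained grows at most linearly. -/
theorem exists_finset_of_near_extremal {p q : ℝ} (hpq : p.HolderConjugate q) {C : ℝ}
    (hC : 1 ≤ C) :
    ∃ B R : ℝ, 0 ≤ B ∧ 0 ≤ R ∧ ∀ g u : ℕ → ℝ, (∀ k, 0 ≤ g k) → (∀ k, 0 ≤ u k) →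
      (∀ k, u k ≤ 1) →
      (∀ j k, j ≤ k → g k ≤ (1 - u j) ^ (1 / p) * ((j : ℝ) + 1) ^ (1 / q) +
        (u j) ^ (1 / p) * (C * ((k : ℝ) - j + 1)) ^ (1 / q)) →
      (∀ k : ℕ, -B ≤ (k : ℝ) - g k ^ q) ∧
      ∀ m : ℕ, ∃ T : Finset ℕ, (∀ k : ℕ, (k : ℝ) - g k ^ q ≤ m → k ∈ T) ∧
        (T.card : ℝ) ≤ R * (m + 1) := by
  have hp := hpq.pos
  have hq := hpq.symm.pos
  have he : 0 < q - 1 := hpq.symm.sub_one_pos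
  set e := q - 1 with he_def
  set B₀ := (1 / 2 : ℝ) ^ (-e) * C with hB₀
  have hB₀0 : 0 ≤ B₀ := by positivity
  set c := min 1 e / 2 with hc
  have hc0 : 0 < c := by rw [hc]; have : 0 < min 1 e := lt_min one_pos he; positivity
  set L := (2 * C) ^ (1 / e) with hL
  have hL1 : 1 ≤ L := Real.one_le_rpow (by linarith) (by positivity)
  have hLe : L ^ (-e) * C = 1 / 2 := by
    rw [hL, ← Real.rpow_mul (by linarith)]
    have : 1 / e * -e = -1 := by field_simp
    rw [this, Real.rpow_neg_one]
    field_simp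
  set M := e * L * Real.exp (e * L) with hM
  have hM0 : 0 < M := by positivity
  set N₀ := 4 * M / c with hN₀
  set W := M * (1 + B₀) / c with hW
  clear_value W N₀ M L c B₀
  have hN₀0 : 0 ≤ N₀ := by rw [hN₀]; positivity
  have hW0 : 0 ≤ W := by rw [hW]; positivity
  refine ⟨1 + B₀, (N₀ * (1 + B₀) + 1) + (8 / 3 * (13 / 8 + 1 + W) + 2), by positivity,
    by positivity, ?_⟩
  intro g u hg hu0 hu1 H
  have H1 : ∀ k, g k ^ q ≤ (1 - c * u k) * ((k : ℝ) + 1 + B₀) := by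
    intro k
    have h := H k k le_rfl
    simp only [sub_self, zero_add, mul_one] at h
    calc g k ^ q ≤ _ := Real.rpow_le_rpow (hg k) h hq.le
      _ ≤ _ := two_term_holder hpq (hu0 k) (hu1 k) (by positivity) (by linarith)
          (η := 1 / 2) (by norm_num)
      _ = (1 - u k / 2) ^ e * ((k : ℝ) + 1 + B₀) := by
          rw [hB₀]; congr 2; ring
      _ ≤ _ := by
          gcongr
          rw [hc]
          exact one_sub_half_rpow_le he (hu0 k) (hu1 k)
  have H2 : ∀ j k : ℕ, j ≤ k →
      g k ^ q ≤ (1 + M * u j) * ((j : ℝ) + 1 + ((k : ℝ) - j + 1) / 2) := by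
    intro j k hjk
    have hjk' : (0 : ℝ) ≤ (k : ℝ) - j := by
      have : (j : ℝ) ≤ k := by exact_mod_cast hjk
      linarith
    have huj := hu0 j
    calc g k ^ q ≤ _ := Real.rpow_le_rpow (hg k) (H j k hjk) hq.le
      _ ≤ _ := two_term_holder hpq (hu0 j) (hu1 j) (by positivity) (by positivity)
          (η := L) (by positivity)
      _ = (1 - u j + L * u j) ^ e * ((j : ℝ) + 1 + ((k : ℝ) - j + 1) / 2) := by
          rw [← mul_assoc, hLe]; ring
      _ ≤ (1 + L * u j) ^ e * ((j : ℝ) + 1 + ((k : ℝ) - j + 1) / 2) := by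
          have : 0 ≤ 1 - u j + L * u j := by nlinarith
          gcongr
          linarith
      _ ≤ _ := by
          gcongr
          rw [hM]
          exact one_add_mul_rpow_le he (by linarith) (hu0 j) (hu1 j)
  refine ⟨fun k => ?_, fun m => ?_⟩
  · have h1 := H1 k
    have h2 : 0 ≤ c * u k := mul_nonneg hc0.le (hu0 k)
    have : (0 : ℝ) ≤ (k : ℝ) + 1 + B₀ := by positivity
    nlinarith
  set n₁ := ⌈N₀ * ((m : ℝ) + 1 + B₀)⌉₊ with hn₁
  set w := 8 / 3 * ((m : ℝ) + 13 / 8 + M * (m + 1 + B₀) / c) with hw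
  have hw0 : 0 ≤ w := by positivity
  have hm0 : (0 : ℝ) ≤ m := by positivity
  clear_value w
  have gap : ∀ j k : ℕ, n₁ ≤ j → j ≤ k → (j : ℝ) - g j ^ q ≤ m → (k : ℝ) - g k ^ q ≤ m →
      (k : ℝ) ≤ j + w := by
    intro j k hj hjk hjm hkm
    have hj' : N₀ * (m + 1 + B₀) ≤ j := by
      refine (Nat.le_ceil _).trans ?_
      rw [← hn₁]
      exact_mod_cast hj
    have hjk' : (j : ℝ) ≤ k := by exact_mod_cast hjk
    have h1 := H1 j
    have h2 := H2 j k hjk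
    have huj := hu0 j
    have h3 : c * u j * ((j : ℝ) + 1 + B₀) ≤ m + 1 + B₀ := by nlinarith
    have h4 : M * u j * ((j : ℝ) + 1) ≤ M * (m + 1 + B₀) / c := by
      rw [le_div_iff₀ hc0]
      have : 0 ≤ c * u j * B₀ := by positivity
      nlinarith
    have h5 : M * u j ≤ 1 / 4 := by
      by_contra hcon
      push Not at hcon
      have h6 : c * u j * (N₀ * (m + 1 + B₀)) ≤ m + 1 + B₀ := by
        refine le_trans ?_ h3
        have : 0 ≤ c * u j := by positivity
        apply mul_le_mul_of_nonneg_left _ this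
        linarith
      have h7 : c * u j * (N₀ * (m + 1 + B₀)) = 4 * (M * u j) * (m + 1 + B₀) := by
        rw [hN₀]; field_simp
      rw [h7] at h6
      have : (0 : ℝ) < m + 1 + B₀ := by positivity
      nlinarith
    have h8 : M * u j * (((k : ℝ) - j + 1) / 2) ≤ 1 / 4 * (((k : ℝ) - j + 1) / 2) := by
      apply mul_le_mul_of_nonneg_right h5
      linarith
    have h9 : (1 + M * u j) * ((j : ℝ) + 1 + ((k : ℝ) - j + 1) / 2) = j + 1 +
        ((k : ℝ) - j + 1) / 2 + M * u j * ((j : ℝ) + 1) +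
        M * u j * (((k : ℝ) - j + 1) / 2) := by ring
    rw [h9] at h2
    rw [hw]
    linarith
  have hwm : w ≤ 8 / 3 * (13 / 8 + 1 + W) * (m + 1) := by
    have h1 : M * (m + 1 + B₀) / c ≤ W * (m + 1) := by
      rw [hW, div_mul_eq_mul_div, div_le_div_iff_of_pos_right hc0, mul_assoc]
      apply mul_le_mul_of_nonneg_left _ hM0.le
      have : (0 : ℝ) ≤ m := by positivity
      nlinarith
    rw [hw]
    have : (0 : ℝ) ≤ m := by positivity
    nlinarith
  have hn₁m : (n₁ : ℝ) ≤ (N₀ * (1 + B₀) + 1) * (m + 1) := by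
    have h1 : (n₁ : ℝ) < N₀ * (m + 1 + B₀) + 1 := Nat.ceil_lt_add_one (by positivity)
    have h2 : N₀ * ((m : ℝ) + 1 + B₀) ≤ N₀ * ((1 + B₀) * (m + 1)) := by
      apply mul_le_mul_of_nonneg_left _ (by positivity)
      have : (0 : ℝ) ≤ m := by positivity
      nlinarith
    have : (0 : ℝ) ≤ m := by positivity
    nlinarith
  obtain ⟨T, hT, hTc⟩ := exists_finset_of_gap (fun k : ℕ => (k : ℝ) - g k ^ q ≤ m) n₁ hw0 gap
  refine ⟨T, hT, ?_⟩
  have h1 : (8 / 3 * (13 / 8 + 1 + W) * ((m : ℝ) + 1)) + (N₀ * (1 + B₀) + 1) * (m + 1) + 1 ≤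
      ((N₀ * (1 + B₀) + 1) + (8 / 3 * (13 / 8 + 1 + W) + 2)) * (m + 1) := by linarith
  linarith

/-- The discrete Adams–Garsia inequality. -/
theorem exists_tsum_exp_le {p q : ℝ} (hpq : p.HolderConjugate q) {C σ : ℝ}
    (hC : 1 ≤ C) (hσ : 0 < σ) :
    ∃ C' : ℝ, 0 ≤ C' ∧ ∀ g u : ℕ → ℝ, (∀ k, 0 ≤ g k) → (∀ k, 0 ≤ u k) → (∀ k, u k ≤ 1) →
      (∀ j k, j ≤ k → g k ≤ (1 - u j) ^ (1 / p) * ((j : ℝ) + 1) ^ (1 / q) +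
        (u j) ^ (1 / p) * (C * ((k : ℝ) - j + 1)) ^ (1 / q)) →
      ∑' k : ℕ, ENNReal.ofReal (Real.exp (σ * (g k ^ q - k))) ≤ ENNReal.ofReal C' := by
  obtain ⟨B, R, hB, hR, H⟩ := exists_finset_of_near_extremal hpq hC
  set w : ℕ → ℝ := fun m => Real.exp (σ * (B + 1)) * Real.exp (-σ) ^ m with hw
  have hw0 : ∀ m, 0 ≤ w m := fun m => by positivity
  have hsum : Summable fun m : ℕ => w m * (R * (m + 1)) := by
    have hr : ‖Real.exp (-σ)‖ < 1 := by
      rw [Real.norm_of_nonneg (Real.exp_pos _).le, Real.exp_lt_one_iff]; linarith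
    have h1 := summable_pow_mul_geometric_of_norm_lt_one 1 hr
    have h2 := summable_geometric_of_norm_lt_one hr
    have h3 := (h1.add h2).mul_left (Real.exp (σ * (B + 1)) * R)
    refine h3.congr fun m => ?_
    simp only [hw, pow_one]; ring
  refine ⟨∑' m : ℕ, w m * (R * (m + 1)), tsum_nonneg fun m => by have := hw0 m; positivity, ?_⟩
  intro g u hg hu0 hu1 hgu
  obtain ⟨hlow, hT⟩ := H g u hg hu0 hu1 hgu
  choose T hT1 hT2 using hT
  have hterm : ∀ k : ℕ, ENNReal.ofReal (Real.exp (σ * (g k ^ q - k))) ≤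
      ∑' m : ℕ, (T m : Set ℕ).indicator (fun _ => ENNReal.ofReal (w m)) k := by
    intro k
    set m := ⌈(k : ℝ) - g k ^ q⌉₊ with hm
    have hk : k ∈ T m := hT1 m k (Nat.le_ceil _)
    refine le_trans ?_ (ENNReal.le_tsum m)
    rw [Set.indicator_of_mem (by exact_mod_cast hk)]
    apply ENNReal.ofReal_le_ofReal
    simp only [hw]
    rw [← Real.exp_nat_mul, ← Real.exp_add]
    apply Real.exp_le_exp.2
    have h1 : (m : ℝ) ≤ (k : ℝ) - g k ^ q + B + 1 := by
      rcases le_total ((k : ℝ) - g k ^ q) 0 with h | h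
      · have : m = 0 := Nat.ceil_eq_zero.2 h
        rw [this]
        have := hlow k
        push_cast
        linarith
      · have := Nat.ceil_lt_add_one h
        rw [← hm] at this
        linarith
    nlinarith
  calc _ ≤ ∑' k : ℕ, ∑' m : ℕ, (T m : Set ℕ).indicator (fun _ => ENNReal.ofReal (w m)) k :=
        ENNReal.tsum_le_tsum hterm
    _ = ∑' m : ℕ, ∑' k : ℕ, (T m : Set ℕ).indicator (fun _ => ENNReal.ofReal (w m)) k :=
        ENNReal.tsum_comm
    _ ≤ ∑' m : ℕ, ENNReal.ofReal (w m * (R * (m + 1))) := by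
        refine ENNReal.tsum_le_tsum fun m => ?_
        rw [← tsum_subtype (T m : Set ℕ) (fun _ => ENNReal.ofReal (w m)),
          Finset.tsum_subtype' (T m) (fun _ => ENNReal.ofReal (w m)), Finset.sum_const, nsmul_eq_mul, mul_comm (w m),
          ENNReal.ofReal_mul (p := R * ((m : ℝ) + 1)) (by positivity)]
        have h1 : ((T m).card : ℝ≥0∞) ≤ ENNReal.ofReal (R * (m + 1)) := by
          rw [← ENNReal.ofReal_natCast]
          exact ENNReal.ofReal_le_ofReal (hT2 m)
        exact mul_le_mul' h1 le_rfl
    _ = _ := (ENNReal.ofReal_tsum_of_nonneg (fun m => by have := hw0 m; positivity) hsum).symm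

/-- A measurable function on a finite measure space has an upper quantile of every order. -/
theorem exists_measure_quantile {X : Type*} [MeasurableSpace X] (μ : Measure X)
    [IsFiniteMeasure μ] {φ : X → ℝ≥0∞} (hφ : Measurable φ) {b : ℝ≥0∞} (hb : b ≤ μ Set.univ) :
    ∃ m : ℝ≥0∞, μ {x | m < φ x} ≤ b ∧ b ≤ μ {x | m ≤ φ x} := by
  set A : Set ℝ≥0∞ := {m | μ {x | m < φ x} ≤ b} with hA
  have hAne : A.Nonempty := ⟨⊤, by simp [hA]⟩
  refine ⟨sInf A, ?_, ?_⟩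
  · obtain ⟨v, hv, hvt, hvA⟩ := exists_seq_tendsto_sInf hAne (OrderBot.bddBelow A)
    have : {x | sInf A < φ x} = ⋃ i, {x | v i < φ x} := by
      ext x
      simp only [Set.mem_ofPred_eq, Set.mem_iUnion]
      constructor
      · intro h
        exact (hvt.eventually (gt_mem_nhds h)).exists
      · rintro ⟨i, hi⟩
        exact lt_of_le_of_lt (sInf_le (hvA i)) hi
    rw [this, Monotone.measure_iUnion]
    · exact iSup_le fun i => hvA i
    · intro i j hij x hx
      exact lt_of_le_of_lt (hv hij) hx
  · rcases eq_or_ne (sInf A) 0 with h0 | h0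
    · simpa [h0] using hb
    obtain ⟨v, hv, hvm, hvt⟩ := exists_seq_strictMono_tendsto' (pos_iff_ne_zero.2 h0)
    have : {x | sInf A ≤ φ x} = ⋂ i, {x | v i < φ x} := by
      ext x
      simp only [Set.mem_ofPred_eq, Set.mem_iInter]
      constructor
      · intro h i
        exact lt_of_lt_of_le (hvm i).2 h
      · intro h
        exact le_of_tendsto' hvt fun i => (h i).le
    rw [this]
    have ht := tendsto_measure_iInter_atTop (μ := μ) (s := fun i => {x | v i < φ x})
      (fun i => (measurableSet_lt measurable_const hφ).nullMeasurableSet)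
      (fun i j hij x hx => lt_of_le_of_lt (hv.monotone hij) hx) ⟨0, measure_ne_top _ _⟩
    refine ge_of_tendsto' ht fun i => ?_
    by_contra hcon
    exact absurd (sInf_le (show v i ∈ A from (not_le.1 hcon).le)) (not_le.2 (hvm i).2)

/-- A set of finite Lebesgue measure contains a subset of any smaller measure on which a given
function is everywhere at least as large as on the rest of the set. -/
theorem exists_superlevel_subset {n : ℕ} (hn : 0 < n)
    {h : EuclideanSpace ℝ (Fin n) → ℝ≥0∞} (hh : Measurable h)
    {S : Set (EuclideanSpace ℝ (Fin n))} (hS : MeasurableSet S) (hSf : volume S ≠ ∞) {b : ℝ≥0∞}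
    (hb : b ≤ volume S) :
    ∃ T ⊆ S, MeasurableSet T ∧ volume T = b ∧ ∀ y ∈ T, ∀ z ∈ S \ T, h z ≤ h y := by
  have : Nonempty (Fin n) := ⟨⟨0, hn⟩⟩
  have : IsFiniteMeasure (volume.restrict S) := ⟨by simpa using hSf.lt_top⟩
  obtain ⟨m, hm1, hm2⟩ := exists_measure_quantile (volume.restrict S) hh (b := b) (by simpa using hb)
  have mgt : MeasurableSet {x | m < h x} := measurableSet_lt measurable_const hh
  have mge : MeasurableSet {x | m ≤ h x} := measurableSet_le measurable_const hh
  have meq : MeasurableSet {x | h x = m} := measurableSet_eq_fun hh measurable_const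
  rw [Measure.restrict_apply mgt] at hm1
  rw [Measure.restrict_apply mge] at hm2
  set A := {x | m < h x} ∩ S with hA
  set D := {x | h x = m} ∩ S with hD
  have hDf : volume D ≠ ∞ := measure_ne_top_of_subset Set.inter_subset_right hSf
  have : IsFiniteMeasure (volume.restrict D) := ⟨by simpa using hDf.lt_top⟩
  have hAD : b ≤ volume A + volume D := by
    refine hm2.trans (le_trans (measure_mono ?_) (measure_union_le _ _))
    rintro x ⟨hx, hxS⟩
    rcases lt_or_eq_of_le (show m ≤ h x from hx) with h1 | h1
    · exact Or.inl ⟨h1, hxS⟩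
    · exact Or.inr ⟨h1.symm, hxS⟩
  obtain ⟨t, ht1, ht2⟩ := exists_measure_quantile (volume.restrict D)
    (φ := fun x => ‖x‖ₑ) measurable_enorm (b := b - volume A)
    (by simpa using tsub_le_iff_left.2 hAD)
  have nlt : MeasurableSet {x : EuclideanSpace ℝ (Fin n) | t < ‖x‖ₑ} :=
    measurableSet_lt measurable_const measurable_enorm
  have nle : MeasurableSet {x : EuclideanSpace ℝ (Fin n) | t ≤ ‖x‖ₑ} :=
    measurableSet_le measurable_const measurable_enorm
  rw [Measure.restrict_apply nlt] at ht1
  rw [Measure.restrict_apply nle] at ht2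
  have hsph : volume {x : EuclideanSpace ℝ (Fin n) | ‖x‖ₑ = t} = 0 := by
    refine measure_mono_null ?_ (Measure.addHaar_sphere volume (0 : EuclideanSpace ℝ (Fin n)) t.toReal)
    intro x hx
    have hx' : ‖x‖ₑ = t := hx
    rw [mem_sphere_zero_iff_norm, ← hx', toReal_enorm]
  have hte : volume ({x | t < ‖x‖ₑ} ∩ D) = b - volume A := by
    refine le_antisymm ht1 (ht2.trans ?_)
    calc volume ({x | t ≤ ‖x‖ₑ} ∩ D)
        ≤ volume (({x | t < ‖x‖ₑ} ∩ D) ∪ {x | ‖x‖ₑ = t}) := by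
          refine measure_mono ?_
          rintro x ⟨hx, hxD⟩
          rcases lt_or_eq_of_le (show t ≤ ‖x‖ₑ from hx) with h1 | h1
          · exact Or.inl ⟨h1, hxD⟩
          · exact Or.inr h1.symm
      _ ≤ _ := measure_union_le _ _
      _ = _ := by rw [hsph, add_zero]
  refine ⟨A ∪ ({x | t < ‖x‖ₑ} ∩ D), ?_, ?_, ?_, ?_⟩
  · rintro x (hx | hx)
    · exact hx.2
    · exact hx.2.2
  · exact (mgt.inter hS).union (nlt.inter (meq.inter hS))
  · rw [measure_union _ (nlt.inter (meq.inter hS)), hte, add_tsub_cancel_of_le hm1]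
    rw [Set.disjoint_left]
    rintro x hx hx'
    have h1 : m < h x := hx.1
    have h2 : h x = m := hx'.2.1
    exact absurd h2 h1.ne'
  · intro y hy z hz
    have h1 : m ≤ h y := by
      rcases hy with hy | hy
      · exact le_of_lt hy.1
      · exact le_of_eq (Eq.symm hy.2.1)
    have h2 : h z ≤ m := by
      by_contra hcon
      exact hz.2 (Or.inl ⟨not_le.1 hcon, hz.1⟩)
    exact h2.trans h1

/-- A set of finite measure is exhausted by nested superlevel sets of measure `e^{-k}|F|`. -/
theorem exists_nested_superlevel {n : ℕ} (hn : 0 < n)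
    {h : EuclideanSpace ℝ (Fin n) → ℝ≥0∞} (hh : Measurable h)
    {F : Set (EuclideanSpace ℝ (Fin n))} (hF : MeasurableSet F) (hFf : volume F ≠ ∞) :
    ∃ S : ℕ → Set (EuclideanSpace ℝ (Fin n)), S 0 = F ∧ Antitone S ∧
      (∀ k, MeasurableSet (S k)) ∧
      (∀ k : ℕ, volume (S k) = volume F * ENNReal.ofReal (Real.exp (-k))) ∧
      ∀ k, ∀ y ∈ S k, ∀ z ∈ F \ S k, h z ≤ h y := by
  have step : ∀ (S : Set (EuclideanSpace ℝ (Fin n))) (b : ℝ≥0∞), ∃ T : Set (EuclideanSpace ℝ (Fin n)),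
      MeasurableSet S → volume S ≠ ∞ → b ≤ volume S →
      T ⊆ S ∧ MeasurableSet T ∧ volume T = b ∧ ∀ y ∈ T, ∀ z ∈ S \ T, h z ≤ h y := by
    intro S b
    by_cases hyp : MeasurableSet S ∧ volume S ≠ ∞ ∧ b ≤ volume S
    · obtain ⟨T, h1, h2, h3, h4⟩ := exists_superlevel_subset hn hh hyp.1 hyp.2.1 hyp.2.2
      exact ⟨T, fun _ _ _ => ⟨h1, h2, h3, h4⟩⟩
    · exact ⟨∅, fun a b c => absurd ⟨a, b, c⟩ hyp⟩
  choose T hT using step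
  let b : ℕ → ℝ≥0∞ := fun k => volume F * ENNReal.ofReal (Real.exp (-k))
  let S : ℕ → Set (EuclideanSpace ℝ (Fin n)) := fun k =>
    Nat.rec F (fun k A => T A (b (k + 1))) k
  have hb : ∀ k, b (k + 1) ≤ b k := by
    intro k
    simp only [b]
    gcongr
    simp
  have hbf : ∀ k, b k ≠ ∞ := fun k => ENNReal.mul_ne_top hFf ENNReal.ofReal_ne_top
  have inv : ∀ k, MeasurableSet (S k) ∧ volume (S k) = b k := by
    intro k
    induction k with
    | zero => exact ⟨hF, by simp [b, S]⟩
    | succ k ih =>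
      obtain ⟨_, h2, h3, _⟩ := hT (S k) (b (k + 1)) ih.1 (ih.2 ▸ hbf k) (ih.2 ▸ hb k)
      exact ⟨h2, h3⟩
  have stp := fun k => hT (S k) (b (k + 1)) (inv k).1 ((inv k).2 ▸ hbf k) ((inv k).2 ▸ hb k)
  refine ⟨S, rfl, antitone_nat_of_succ_le fun k => (stp k).1, fun k => (inv k).1,
    fun k => (inv k).2, ?_⟩
  intro k
  induction k with
  | zero => rintro y _ z ⟨h1, h2⟩; exact absurd h1 h2
  | succ k ih =>
    intro y hy z hz
    rcases Classical.em (z ∈ S k) with hzk | hzk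
    · exact (stp k).2.2.2 y hy z ⟨hzk, hz.2⟩
    · exact ih y ((stp k).1 hy) z ⟨hz.1, hzk⟩

/-- Integrability of a negative power of the distance near its pole, for measures with a power
growth bound. -/
theorem exists_lintegral_ball_rpow_le {n : ℕ} {Q b d : ℝ} (hQ : 0 ≤ Q) (hb : 0 < b) (hbd : b < d) :
    ∃ C : ℝ, 0 ≤ C ∧ ∀ μ : Measure (EuclideanSpace ℝ (Fin n)),
      (∀ (x : EuclideanSpace ℝ (Fin n)) (r : ℝ), 0 < r →
        μ (Metric.ball x r) ≤ ENNReal.ofReal (Q * r ^ d)) →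
      ∀ (x : EuclideanSpace ℝ (Fin n)) (ρ : ℝ), 0 < ρ →
        ∫⁻ y in Metric.ball x ρ, ENNReal.ofReal (‖x - y‖ ^ (-b)) ∂μ ≤
          ENNReal.ofReal (C * ρ ^ (d - b)) := by
  set θ : ℝ := (1 / 2 : ℝ) ^ (d - b) with hθ
  have hθ0 : 0 < θ := by positivity
  have hθ1 : θ < 1 := Real.rpow_lt_one (by norm_num) (by norm_num) (by linarith)
  refine ⟨Q * 2 ^ d * 2 ^ b * (1 - θ)⁻¹, by
    have : 0 < 1 - θ := by linarith
    positivity, ?_⟩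
  intro μ hμ x ρ hρ
  set w : ℕ → ℝ := fun i => ((1 / 2 : ℝ) ^ (i + 1) * ρ) ^ (-b) with hw
  have hpt : ∀ y ∈ Metric.ball x ρ, ENNReal.ofReal (‖x - y‖ ^ (-b)) ≤
      ∑' i : ℕ, (Metric.ball x (2 * ((1 / 2 : ℝ) ^ i * ρ))).indicator
        (fun _ => ENNReal.ofReal (w i)) y := by
    intro y hy
    rcases eq_or_ne x y with rfl | hxy
    · simp [Real.zero_rpow (neg_ne_zero.2 hb.ne')]
    have h0 : 0 < ‖x - y‖ := norm_pos_iff.2 (sub_ne_zero.2 hxy)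
    have h1 : ‖x - y‖ < ρ := by rwa [← dist_eq_norm, dist_comm]
    obtain ⟨i, hi1, hi2⟩ := exists_nat_pow_near_of_lt_one (x := ‖x - y‖ / ρ) (y := 1 / 2)
      (by positivity) ((div_le_one hρ).2 h1.le) (by norm_num) (by norm_num)
    rw [lt_div_iff₀ hρ] at hi1
    rw [div_le_iff₀ hρ] at hi2
    refine le_trans ?_ (ENNReal.le_tsum i)
    rw [Set.indicator_of_mem]
    · exact ENNReal.ofReal_le_ofReal
        (Real.rpow_le_rpow_of_nonpos (by positivity) hi1.le (by linarith))
    · rw [Metric.mem_ball, dist_comm, dist_eq_norm]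
      linarith
  calc _ ≤ ∫⁻ y in Metric.ball x ρ, ∑' i : ℕ, (Metric.ball x (2 * ((1 / 2 : ℝ) ^ i * ρ))).indicator
        (fun _ => ENNReal.ofReal (w i)) y ∂μ := setLIntegral_mono' measurableSet_ball hpt
    _ ≤ ∫⁻ y, ∑' i : ℕ, (Metric.ball x (2 * ((1 / 2 : ℝ) ^ i * ρ))).indicator
        (fun _ => ENNReal.ofReal (w i)) y ∂μ := setLIntegral_le_lintegral _ _
    _ = ∑' i : ℕ, ENNReal.ofReal (w i) * μ (Metric.ball x (2 * ((1 / 2 : ℝ) ^ i * ρ))) := by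
        rw [lintegral_tsum fun i => (measurable_const.indicator measurableSet_ball).aemeasurable]
        congr 1
        ext i
        rw [lintegral_indicator_const measurableSet_ball]
    _ ≤ ∑' i : ℕ, ENNReal.ofReal (Q * 2 ^ d * 2 ^ b * ρ ^ (d - b) * θ ^ i) := by
        refine ENNReal.tsum_le_tsum fun i => ?_
        have hi : 0 < (1 / 2 : ℝ) ^ i := by positivity
        refine (mul_le_mul_right (hμ x _ (by positivity)) _).trans ?_
        rw [← ENNReal.ofReal_mul (by positivity)]
        refine ENNReal.ofReal_le_ofReal (le_of_eq ?_)
        simp only [hw]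
        rw [pow_succ, Real.mul_rpow (by positivity) hρ.le, Real.mul_rpow hi.le (by norm_num),
          Real.mul_rpow (by norm_num : (0:ℝ) ≤ 2) (by positivity), Real.mul_rpow hi.le hρ.le,
          one_div, Real.inv_rpow (by norm_num : (0:ℝ) ≤ 2), ← Real.rpow_neg (by norm_num), neg_neg,
          Real.rpow_sub hρ, hθ, Real.rpow_neg hρ.le, Real.rpow_neg (by positivity),
          ← Real.rpow_natCast ((1 / 2 : ℝ) ^ (d - b)), ← Real.rpow_mul (by norm_num),
          mul_comm (d - b), Real.rpow_mul (by norm_num), Real.rpow_natCast, one_div,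
          Real.rpow_sub (by positivity)]
        ring
    _ = ENNReal.ofReal (∑' i : ℕ, Q * 2 ^ d * 2 ^ b * ρ ^ (d - b) * θ ^ i) := by
        rw [ENNReal.ofReal_tsum_of_nonneg (fun i => by positivity)]
        exact (summable_geometric_of_lt_one hθ0.le hθ1).mul_left _
    _ = _ := by
        rw [tsum_mul_left, tsum_geometric_of_lt_one hθ0.le hθ1]
        congr 1
        ring

theorem lintegral_rpow_le_of_ball_le {n : ℕ} {b : ℝ} (hb : 0 ≤ b)
    {μ : Measure (EuclideanSpace ℝ (Fin n))} {x : EuclideanSpace ℝ (Fin n)} {ρ : ℝ} (hρ : 0 < ρ)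
    {c : ℝ≥0∞} (hc : ∫⁻ y in Metric.ball x ρ, ENNReal.ofReal (‖x - y‖ ^ (-b)) ∂μ ≤ c)
    (G : Set (EuclideanSpace ℝ (Fin n))) :
    ∫⁻ y in G, ENNReal.ofReal (‖x - y‖ ^ (-b)) ∂μ ≤ c + ENNReal.ofReal (ρ ^ (-b)) * μ G := by
  calc _ ≤ ∫⁻ y in Metric.ball x ρ ∪ (G \ Metric.ball x ρ), ENNReal.ofReal (‖x - y‖ ^ (-b)) ∂μ :=
        lintegral_mono_set (by intro y hy; by_cases h : y ∈ Metric.ball x ρ <;> simp_all)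
    _ ≤ _ := lintegral_union_le _ _ _
    _ ≤ c + ∫⁻ y in G \ Metric.ball x ρ, ENNReal.ofReal (ρ ^ (-b)) ∂μ := by
        refine add_le_add hc (setLIntegral_mono measurable_const fun y hy => ?_)
        refine ENNReal.ofReal_le_ofReal (Real.rpow_le_rpow_of_nonpos hρ ?_ (by linarith))
        have := hy.2
        rw [Metric.mem_ball, dist_comm, dist_eq_norm] at this
        linarith
    _ ≤ _ := by
        rw [setLIntegral_const]
        gcongr
        exact Set.sdiff_subset

theorem lintegral_annulus_rpow_neg {n : ℕ} (hn : 0 < n) (x : EuclideanSpace ℝ (Fin n)) {r R : ℝ}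
    (hr : 0 < r) (hrR : r ≤ R) :
    ∫⁻ y in Metric.ball x R \ Metric.ball x r, ENNReal.ofReal (‖x - y‖ ^ (-(n : ℝ))) =
      ENNReal.ofReal (n * unitBallVolume n * Real.log (R / r)) := by
  have : Nonempty (Fin n) := ⟨⟨0, hn⟩⟩
  set φ : ℝ → ℝ := (Set.Ico r R).indicator fun t => t ^ (-(n : ℝ)) with hφ
  have hφ0 : ∀ t, 0 ≤ φ t := fun t => Set.indicator_nonneg
    (fun s hs => Real.rpow_nonneg (hr.le.trans hs.1) _) t
  have heq : ∀ t ∈ Set.Ioi (0 : ℝ), t ^ (n - 1) • φ t = (Set.Ico r R).indicator (fun t => t⁻¹) t := by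
    intro t ht
    have ht0 : 0 < t := ht
    by_cases h : t ∈ Set.Ico r R
    · rw [hφ, Set.indicator_of_mem h, Set.indicator_of_mem h, Real.rpow_neg ht0.le,
        Real.rpow_natCast, smul_eq_mul]
      obtain ⟨m, rfl⟩ : ∃ m, n = m + 1 := ⟨n - 1, by omega⟩
      rw [Nat.add_sub_cancel, pow_succ]
      field_simp
    · rw [hφ, Set.indicator_of_notMem h, Set.indicator_of_notMem h, smul_zero]
  have hcont : ContinuousOn (fun t : ℝ => t⁻¹) (Set.Icc r R) :=
    continuousOn_inv₀.mono fun t ht => (lt_of_lt_of_le hr ht.1).ne'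
  have hint : Integrable (fun y : EuclideanSpace ℝ (Fin n) => φ ‖y‖) := by
    rw [integrable_fun_norm_addHaar, finrank_euclideanSpace_fin, integrableOn_congr_fun heq measurableSet_Ioi]
    refine Integrable.integrableOn ?_
    rw [integrable_indicator_iff measurableSet_Ico]
    exact (hcont.integrableOn_Icc).mono_set Set.Ico_subset_Icc_self
  have hval : ∫ y : EuclideanSpace ℝ (Fin n), φ ‖y‖ = n * unitBallVolume n * Real.log (R / r) := by
    rw [integral_fun_norm_addHaar, finrank_euclideanSpace_fin,
      setIntegral_congr_fun measurableSet_Ioi heq, setIntegral_indicator measurableSet_Ico]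
    have : Set.Ioi (0 : ℝ) ∩ Set.Ico r R = Set.Ico r R :=
      Set.inter_eq_right.2 fun t ht => lt_of_lt_of_le hr ht.1
    rw [this, integral_Ico_eq_integral_Ioc, ← intervalIntegral.integral_of_le hrR,
      integral_inv_of_pos hr (hr.trans_le hrR)]
    simp [unitBallVolume, Measure.real, mul_assoc]
  have hms : MeasurableSet (Metric.ball x R \ Metric.ball x r) :=
    measurableSet_ball.diff measurableSet_ball
  rw [← hval, ofReal_integral_eq_lintegral_ofReal hint (ae_of_all _ fun y => hφ0 _),
    ← lintegral_sub_left_eq_self (μ := (volume : Measure (EuclideanSpace ℝ (Fin n))))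
      (fun y => ENNReal.ofReal (φ ‖y‖)) x, ← lintegral_indicator hms]
  refine lintegral_congr fun y => ?_
  by_cases h : y ∈ Metric.ball x R \ Metric.ball x r
  · rw [Set.indicator_of_mem h, hφ, Set.indicator_of_mem]
    rw [Set.mem_sdiff, Metric.mem_ball, Metric.mem_ball, dist_comm, dist_eq_norm] at h
    exact ⟨not_lt.1 h.2, h.1⟩
  · rw [Set.indicator_of_notMem h, hφ, Set.indicator_of_notMem, ENNReal.ofReal_zero]
    rw [Set.mem_sdiff, Metric.mem_ball, Metric.mem_ball, dist_comm, dist_eq_norm] at h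
    intro h'
    exact h ⟨h'.2, not_lt.2 h'.1⟩

theorem unitBallVolume_pos (n : ℕ) : 0 < unitBallVolume n :=
  ENNReal.toReal_pos (Metric.measure_ball_pos volume _ one_pos).ne' measure_ball_lt_top.ne

theorem volume_ball_eq_unitBallVolume {n : ℕ} (x : EuclideanSpace ℝ (Fin n)) {r : ℝ} (hr : 0 < r) :
    volume (Metric.ball x r) = ENNReal.ofReal (unitBallVolume n * r ^ (n : ℝ)) := by
  rw [Measure.addHaar_ball_of_pos volume x hr, finrank_euclideanSpace_fin, mul_comm,
    ENNReal.ofReal_mul (unitBallVolume_pos n).le, unitBallVolume, Real.rpow_natCast,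
    ENNReal.ofReal_toReal measure_ball_lt_top.ne]

theorem lintegral_diff_ball_rpow_neg_le {n : ℕ} (hn : 0 < n) (x : EuclideanSpace ℝ (Fin n)) {r W : ℝ}
    (hr : 0 < r) {G : Set (EuclideanSpace ℝ (Fin n))} (hG : volume G ≤ ENNReal.ofReal W)
    (hW : unitBallVolume n * r ^ (n : ℝ) ≤ W) :
    ∫⁻ y in G \ Metric.ball x r, ENNReal.ofReal (‖x - y‖ ^ (-(n : ℝ))) ≤
      ENNReal.ofReal (unitBallVolume n * (Real.log (W / (unitBallVolume n * r ^ (n : ℝ))) + 1)) := by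
  have hA := unitBallVolume_pos n
  set A := unitBallVolume n with hAdef
  have hn' : (0 : ℝ) < n := by exact_mod_cast hn
  have hrn : 0 < r ^ (n : ℝ) := by positivity
  have hW0 : 0 < W := lt_of_lt_of_le (by positivity) hW
  set R := (W / A) ^ (1 / (n : ℝ)) with hR
  have hRn : R ^ (n : ℝ) = W / A := by
    rw [hR, ← Real.rpow_mul (by positivity), one_div_mul_cancel hn'.ne', Real.rpow_one]
  have hR0 : 0 < R := by positivity
  have hrR : r ≤ R := by
    rw [← Real.rpow_le_rpow_iff hr.le hR0.le hn', hRn, le_div_iff₀ hA]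
    linarith
  have hlog : 0 ≤ Real.log (R / r) := Real.log_nonneg ((one_le_div hr).2 hrR)
  have hlogeq : Real.log (W / (A * r ^ (n : ℝ))) = n * Real.log (R / r) := by
    rw [← Real.log_rpow (by positivity), Real.div_rpow hR0.le hr.le, hRn, div_div]
  calc _ ≤ ∫⁻ y in (Metric.ball x R \ Metric.ball x r) ∪ (G \ Metric.ball x R),
          ENNReal.ofReal (‖x - y‖ ^ (-(n : ℝ))) := by
        refine lintegral_mono_set fun y hy => ?_
        by_cases h : y ∈ Metric.ball x R
        · exact Or.inl ⟨h, hy.2⟩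
        · exact Or.inr ⟨hy.1, h⟩
    _ ≤ _ := lintegral_union_le _ _ _
    _ ≤ ENNReal.ofReal (n * A * Real.log (R / r)) +
          ∫⁻ y in G \ Metric.ball x R, ENNReal.ofReal (R ^ (-(n : ℝ))) := by
        rw [lintegral_annulus_rpow_neg hn x hr hrR]
        refine add_le_add le_rfl (setLIntegral_mono measurable_const fun y hy => ?_)
        refine ENNReal.ofReal_le_ofReal (Real.rpow_le_rpow_of_nonpos hR0 ?_ (by linarith))
        have := hy.2
        rw [Metric.mem_ball, dist_comm, dist_eq_norm] at this
        linarith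
    _ ≤ ENNReal.ofReal (n * A * Real.log (R / r)) + ENNReal.ofReal A := by
        rw [setLIntegral_const]
        gcongr
        calc _ ≤ ENNReal.ofReal (R ^ (-(n : ℝ))) * ENNReal.ofReal W :=
              mul_le_mul' le_rfl ((measure_mono Set.sdiff_subset).trans hG)
          _ = _ := by
              rw [← ENNReal.ofReal_mul (by positivity), Real.rpow_neg hR0.le, hRn]
              congr 1
              field_simp
    _ = _ := by
        rw [← ENNReal.ofReal_add (by positivity) hA.le, hlogeq]
        congr 1
        ring

theorem holderConjugate_riesz {n α : ℝ} (hα : 0 < α) (hαn : α < n) :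
    (n / α).HolderConjugate (n / (n - α)) := by
  have h1 : 0 < n - α := by linarith
  have h2 : 0 < n := by linarith
  rw [Real.holderConjugate_iff]
  refine ⟨(one_lt_div hα).2 hαn, ?_⟩
  rw [inv_div, inv_div, ← add_div, add_sub_cancel, div_self h2.ne']

theorem measurable_riesz_kernel {n : ℕ} (e : ℝ) : Measurable
    fun z : EuclideanSpace ℝ (Fin n) × EuclideanSpace ℝ (Fin n) =>
      ENNReal.ofReal (‖z.1 - z.2‖ ^ e) := by
  fun_prop

theorem measurable_lintegral_riesz {n : ℕ} (e : ℝ) {h : EuclideanSpace ℝ (Fin n) → ℝ≥0∞}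
    (hh : Measurable h) (S : Set (EuclideanSpace ℝ (Fin n))) :
    Measurable fun x : EuclideanSpace ℝ (Fin n) =>
      ∫⁻ y in S, ENNReal.ofReal (‖x - y‖ ^ e) * h y :=
  ((measurable_riesz_kernel e).mul (hh.comp measurable_snd)).lintegral_prod_right'

/-- The Riesz potential of a function bounded by `m` on `G`: the part near `x` is estimated by
`m`, the part far from `x` by Hölder's inequality. -/
theorem setLIntegral_riesz_le {n : ℕ} (hn : 0 < n) {α : ℝ} (hα : 0 < α) (hαn : α < n) {C₀ : ℝ}
    (hC₀ : 0 ≤ C₀) {x : EuclideanSpace ℝ (Fin n)} {r : ℝ} (hr : 0 < r)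
    (hC : ∫⁻ y in Metric.ball x r, ENNReal.ofReal (‖x - y‖ ^ (α - n)) ≤ ENNReal.ofReal (C₀ * r ^ α))
    {h : EuclideanSpace ℝ (Fin n) → ℝ≥0∞} (hh : Measurable h)
    {G : Set (EuclideanSpace ℝ (Fin n))} {m u W : ℝ} (hm : 0 ≤ m)
    (hu : 0 ≤ u) (hGm : ∀ y ∈ G, h y ≤ ENNReal.ofReal m)
    (hGu : ∫⁻ y in G, h y ^ ((n : ℝ) / α) ≤ ENNReal.ofReal u)
    (hG : volume G ≤ ENNReal.ofReal W) (hW : unitBallVolume n * r ^ (n : ℝ) ≤ W) :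
    ∫⁻ y in G, ENNReal.ofReal (‖x - y‖ ^ (α - n)) * h y ≤
      ENNReal.ofReal (m * (C₀ * r ^ α) + u ^ (1 / ((n : ℝ) / α)) * (unitBallVolume n *
        (Real.log (W / (unitBallVolume n * r ^ (n : ℝ))) + 1)) ^ (1 / ((n : ℝ) / (n - α)))) := by
  have hpq := holderConjugate_riesz hα hαn
  set p := (n : ℝ) / α
  set q := (n : ℝ) / (n - α) with hq
  have hA := unitBallVolume_pos n
  have hlog : 0 ≤ Real.log (W / (unitBallVolume n * r ^ (n : ℝ))) :=
    Real.log_nonneg ((one_le_div (by positivity)).2 hW)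
  have hnear : ∫⁻ y in G ∩ Metric.ball x r, ENNReal.ofReal (‖x - y‖ ^ (α - n)) * h y ≤
      ENNReal.ofReal (m * (C₀ * r ^ α)) := by
    calc _ ≤ ∫⁻ y in G ∩ Metric.ball x r,
            ENNReal.ofReal (‖x - y‖ ^ (α - n)) * ENNReal.ofReal m :=
          setLIntegral_mono (by fun_prop) fun y hy => mul_le_mul' le_rfl (hGm y hy.1)
      _ ≤ ∫⁻ y in Metric.ball x r, ENNReal.ofReal (‖x - y‖ ^ (α - n)) * ENNReal.ofReal m :=
          lintegral_mono_set Set.inter_subset_right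
      _ ≤ ENNReal.ofReal (C₀ * r ^ α) * ENNReal.ofReal m := by
          rw [lintegral_mul_const _ (by fun_prop)]
          exact mul_le_mul' hC le_rfl
      _ = _ := by rw [mul_comm, ← ENNReal.ofReal_mul hm]
  have hfar : ∫⁻ y in G \ Metric.ball x r, ENNReal.ofReal (‖x - y‖ ^ (α - n)) * h y ≤
      ENNReal.ofReal (u ^ (1 / p) * (unitBallVolume n *
        (Real.log (W / (unitBallVolume n * r ^ (n : ℝ))) + 1)) ^ (1 / q)) := by
    have h1 := ENNReal.lintegral_mul_le_Lp_mul_Lq (volume.restrict (G \ Metric.ball x r)) hpq.symm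
      (f := fun y => ENNReal.ofReal (‖x - y‖ ^ (α - n))) (g := h) (by fun_prop) hh.aemeasurable
    refine h1.trans ?_
    rw [mul_comm (u ^ (1 / p)), ENNReal.ofReal_mul (by positivity),
      ← ENNReal.ofReal_rpow_of_nonneg (by positivity) (by have := hpq.symm.pos; positivity),
      ← ENNReal.ofReal_rpow_of_nonneg hu (by have := hpq.pos; positivity)]
    refine mul_le_mul' (ENNReal.rpow_le_rpow ?_ (by have := hpq.symm.pos; positivity))
      (ENNReal.rpow_le_rpow ((lintegral_mono_set Set.sdiff_subset).trans hGu)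
        (by have := hpq.pos; positivity))
    refine le_trans (le_of_eq ?_) (lintegral_diff_ball_rpow_neg_le hn x hr hG hW)
    refine lintegral_congr fun y => ?_
    rw [ENNReal.ofReal_rpow_of_nonneg (by positivity) hpq.symm.nonneg, ← Real.rpow_mul (by positivity)]
    congr 2
    have : (n : ℝ) - α ≠ 0 := by linarith
    rw [hq]
    field_simp
    ring
  calc _ ≤ ∫⁻ y in (G ∩ Metric.ball x r) ∪ (G \ Metric.ball x r),
          ENNReal.ofReal (‖x - y‖ ^ (α - n)) * h y := by rw [Set.inter_union_sdiff]
    _ ≤ _ := lintegral_union_le _ _ _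
    _ ≤ _ := add_le_add hnear hfar
    _ = _ := (ENNReal.ofReal_add (by positivity) (by positivity)).symm

/-- The Riesz potential of a function truncated at the levels of its distribution function. -/
theorem exists_setLIntegral_riesz_sdiff_superlevel_le {n : ℕ} (hn : 0 < n) {α : ℝ} (hα : 0 < α)
    (hαn : α < n) :
    ∃ C₁ : ℝ, 0 ≤ C₁ ∧ ∀ (h : EuclideanSpace ℝ (Fin n) → ℝ≥0∞) (V : ℝ)
      (S : ℕ → Set (EuclideanSpace ℝ (Fin n))), Measurable h → 0 < V → Antitone S →
      (∀ k, MeasurableSet (S k)) →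
      (∀ k : ℕ, volume (S k) = ENNReal.ofReal (V * Real.exp (-k))) →
      (∀ k, ∀ y ∈ S k, ∀ z ∈ S 0 \ S k, h z ≤ h y) →
      (∫⁻ y in S 0, h y ^ ((n : ℝ) / α) ≤ 1) →
      ∀ j k : ℕ, j ≤ k → ∀ x : EuclideanSpace ℝ (Fin n),
        ∫⁻ y in S 0 \ S k, ENNReal.ofReal (‖x - y‖ ^ (α - n)) * h y ≤
          ENNReal.ofReal (unitBallVolume n ^ (1 / ((n : ℝ) / (n - α))) *
            ((1 - (∫⁻ y in S j, h y ^ ((n : ℝ) / α)).toReal) ^ (1 / ((n : ℝ) / α)) *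
              ((j : ℝ) + 1) ^ (1 / ((n : ℝ) / (n - α))) +
            (∫⁻ y in S j, h y ^ ((n : ℝ) / α)).toReal ^ (1 / ((n : ℝ) / α)) *
              (((k : ℝ) - j + 1) ^ (1 / ((n : ℝ) / (n - α))) + C₁))) := by
  have hpq := holderConjugate_riesz hα hαn
  have hn' : (0 : ℝ) < n := by exact_mod_cast hn
  have hpdef : 1 / ((n : ℝ) / α) = α / n := by rw [one_div_div]
  set p := (n : ℝ) / α with hp
  set q := (n : ℝ) / (n - α) with hq
  have hp0 : 0 < p := hpq.pos
  have hq0 : 0 < q := hpq.symm.pos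
  have hA := unitBallVolume_pos n
  set A := unitBallVolume n with hAdef
  obtain ⟨C₀, hC₀, hC⟩ := exists_lintegral_ball_rpow_le (n := n) (Q := A) (b := n - α) (d := n)
    hA.le (by linarith) (by linarith)
  have hC := hC volume fun x r hr => (volume_ball_eq_unitBallVolume x hr).le
  simp only [neg_sub, sub_sub_cancel] at hC
  refine ⟨2 * C₀ / A, by positivity, ?_⟩
  intro h V S hh hV hS hSm hSv hSh h1 j k hjk x
  set u : ℕ → ℝ := fun k => (∫⁻ y in S k, h y ^ p).toReal with hu
  have hufin : ∀ k, ∫⁻ y in S k, h y ^ p ≤ 1 := fun k =>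
    (lintegral_mono_set (hS (Nat.zero_le k))).trans h1
  have hueq : ∀ k, ENNReal.ofReal (u k) = ∫⁻ y in S k, h y ^ p := fun k =>
    ENNReal.ofReal_toReal (ne_top_of_le_ne_top ENNReal.one_ne_top (hufin k))
  have hu0 : ∀ k, 0 ≤ u k := fun k => ENNReal.toReal_nonneg
  have hu1 : ∀ k, u k ≤ 1 := fun k => ENNReal.toReal_le_of_le_ofReal zero_le_one (by simpa using hufin k)
  have huanti : u k ≤ u j := by
    apply ENNReal.toReal_mono (ne_top_of_le_ne_top ENNReal.one_ne_top (hufin j))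
    exact lintegral_mono_set (hS hjk)
  have hpos : ∀ k : ℕ, 0 < V * Real.exp (-k) := fun k => by positivity
  have hlev : ∀ k, ∃ m : ℝ, 0 ≤ m ∧ (∀ z ∈ S 0 \ S k, h z ≤ ENNReal.ofReal m) ∧
      m * (V * Real.exp (-k)) ^ (1 / p) ≤ u k ^ (1 / p) := by
    intro k
    set s := ⨆ z ∈ S 0 \ S k, h z with hs
    have hsle : ∀ y ∈ S k, s ≤ h y := fun y hy => iSup₂_le fun z hz => hSh k y hy z hz
    have hint : s ^ p * ENNReal.ofReal (V * Real.exp (-k)) ≤ ENNReal.ofReal (u k) := by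
      rw [hueq, ← hSv, ← setLIntegral_const]
      exact setLIntegral_mono (hh.pow_const p) fun y hy => ENNReal.rpow_le_rpow (hsle y hy) hp0.le
    have hsfin : s ≠ ∞ := by
      intro hs_eq
      rw [hs_eq, ENNReal.top_rpow_of_pos hp0, ENNReal.top_mul (by simpa using hpos k)] at hint
      exact absurd hint (by simp)
    refine ⟨s.toReal, ENNReal.toReal_nonneg, fun z hz => ?_, ?_⟩
    · rw [ENNReal.ofReal_toReal hsfin]
      exact le_iSup₂ (f := fun z _ => h z) z hz
    · rw [← ENNReal.ofReal_toReal hsfin, ENNReal.ofReal_rpow_of_nonneg ENNReal.toReal_nonneg hp0.le,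
        ← ENNReal.ofReal_mul (by positivity), ENNReal.ofReal_le_ofReal_iff (hu0 k)] at hint
      have := Real.rpow_le_rpow (by positivity) hint (show 0 ≤ 1 / p by positivity)
      rwa [Real.mul_rpow (by positivity) (hpos k).le, ← Real.rpow_mul ENNReal.toReal_nonneg,
        mul_one_div_cancel hp0.ne', Real.rpow_one] at this
  choose m hm0 hmle hmu using hlev
  set r : ℕ → ℝ := fun k => (V * Real.exp (-k) / A) ^ (1 / (n : ℝ)) with hr
  have hr0 : ∀ k, 0 < r k := fun k => by have := hpos k; positivity
  have hrn : ∀ k, A * r k ^ (n : ℝ) = V * Real.exp (-k) := by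
    intro k
    have := hpos k
    rw [hr, ← Real.rpow_mul (by positivity), one_div_mul_cancel hn'.ne', Real.rpow_one]
    field_simp
  have hnear : ∀ k, m k * (C₀ * r k ^ α) ≤ A ^ (1 / q) * (C₀ / A * u k ^ (1 / p)) := by
    intro k
    have h2 := hpos k
    have h3 : r k ^ α = (V * Real.exp (-k)) ^ (1 / p) * (A ^ (1 / p))⁻¹ := by
      rw [hr, ← Real.rpow_mul (by positivity), Real.div_rpow h2.le hA.le, hpdef, div_eq_mul_inv,
        one_div_mul_eq_div]
    have h4 : A ^ (1 / q) * A ^ (1 / p) = A := by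
      rw [← Real.rpow_add hA, one_div, one_div, add_comm, hpq.inv_add_inv_eq_one, Real.rpow_one]
    have h5 : 0 < A ^ (1 / p) := by positivity
    have h6 : A ^ (1 / q) / A = (A ^ (1 / p))⁻¹ := by
      rw [div_eq_iff hA.ne', eq_inv_mul_iff_mul_eq₀ h5.ne']
      linarith
    calc m k * (C₀ * r k ^ α) = C₀ * (A ^ (1 / p))⁻¹ * (m k * (V * Real.exp (-k)) ^ (1 / p)) := by
          rw [h3]; ring
      _ ≤ C₀ * (A ^ (1 / p))⁻¹ * u k ^ (1 / p) := by
          have := hmu k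
          gcongr
      _ = _ := by rw [← h6]; ring
  have hrest : ∫⁻ y in S 0 \ S j, h y ^ p ≤ ENNReal.ofReal (1 - u j) := by
    have h2 := lintegral_inter_add_sdiff (μ := volume) (fun y => h y ^ p) (S 0) (hSm j)
    rw [Set.inter_eq_right.2 (hS (Nat.zero_le j)), ← hueq] at h2
    rw [ENNReal.ofReal_sub _ (hu0 j), ENNReal.ofReal_one]
    exact ENNReal.le_sub_of_add_le_left ENNReal.ofReal_ne_top (h2.trans_le h1)
  have b1 := setLIntegral_riesz_le hn hα hαn hC₀ (hr0 j) (hC x _ (hr0 j)) hh (hm0 j)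
    (sub_nonneg.2 (hu1 j)) (hmle j) hrest
    (W := V) ((measure_mono Set.sdiff_subset).trans (by rw [hSv]; simp))
    (by
      rw [← hAdef, hrn]
      exact mul_le_of_le_one_right hV.le (by simp))
  have b2 := setLIntegral_riesz_le hn hα hαn hC₀ (hr0 k) (hC x _ (hr0 k)) hh (hm0 k) (hu0 j)
    (G := S j \ S k) (fun z hz => hmle k z ⟨hS (Nat.zero_le j) hz.1, hz.2⟩)
    ((lintegral_mono_set Set.sdiff_subset).trans (hueq j).ge)
    (W := V * Real.exp (-j)) ((measure_mono Set.sdiff_subset).trans (hSv j).le)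
    (by
      rw [← hAdef, hrn]
      have : (j : ℝ) ≤ k := by exact_mod_cast hjk
      gcongr)
  rw [← hAdef, hrn, ← hp, ← hq] at b1 b2
  have e1 : Real.log (V / (V * Real.exp (-j))) = j := by
    rw [div_mul_cancel_left₀ hV.ne', ← Real.exp_neg, Real.log_exp, neg_neg]
  have e2 : Real.log (V * Real.exp (-j) / (V * Real.exp (-k))) = (k : ℝ) - j := by
    rw [mul_div_mul_left _ _ hV.ne', ← Real.exp_sub, Real.log_exp]
    ring
  have hjk' : (0 : ℝ) ≤ (k : ℝ) - j + 1 := by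
    have : (j : ℝ) ≤ k := by exact_mod_cast hjk
    linarith
  rw [e1, Real.mul_rpow hA.le (by positivity)] at b1
  rw [e2, Real.mul_rpow hA.le hjk'] at b2
  have hu1j : 0 ≤ 1 - u j := sub_nonneg.2 (hu1 j)
  have huj := hu0 j
  have hmj := hm0 j
  have hmk := hm0 k
  have hrj := (hr0 j).le
  have hrk := (hr0 k).le
  calc _ ≤ ∫⁻ y in (S 0 \ S j) ∪ (S j \ S k), ENNReal.ofReal (‖x - y‖ ^ (α - n)) * h y := by
        refine lintegral_mono_set fun y hy => ?_
        by_cases hyj : y ∈ S j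
        · exact Or.inr ⟨hyj, hy.2⟩
        · exact Or.inl ⟨hy.1, hyj⟩
    _ ≤ _ := lintegral_union_le _ _ _
    _ ≤ _ := add_le_add b1 b2
    _ = _ := (ENNReal.ofReal_add (by positivity) (by positivity)).symm
    _ ≤ _ := by
        refine ENNReal.ofReal_le_ofReal ?_
        have h2 := hnear j
        have h3 := hnear k
        have h4 : u k ^ (1 / p) ≤ u j ^ (1 / p) :=
          Real.rpow_le_rpow (hu0 k) huanti (by positivity)
        have h5 : A ^ (1 / q) * (C₀ / A * u k ^ (1 / p)) ≤ A ^ (1 / q) * (C₀ / A * u j ^ (1 / p)) := by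
          gcongr
        have h6 : A ^ (1 / q) * (u j ^ (1 / p) * (2 * C₀ / A)) =
            2 * (A ^ (1 / q) * (C₀ / A * u j ^ (1 / p))) := by ring
        have h7 : A ^ (1 / q) * ((1 - u j) ^ (1 / p) * ((j : ℝ) + 1) ^ (1 / q) +
            u j ^ (1 / p) * (((k : ℝ) - j + 1) ^ (1 / q) + 2 * C₀ / A)) =
            (1 - u j) ^ (1 / p) * (A ^ (1 / q) * ((j : ℝ) + 1) ^ (1 / q)) +
            u j ^ (1 / p) * (A ^ (1 / q) * ((k : ℝ) - j + 1) ^ (1 / q)) +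
            A ^ (1 / q) * (u j ^ (1 / p) * (2 * C₀ / A)) := by ring
        rw [h7, h6]
        linarith

/-- A restricted weak-type estimate for the Riesz potential with respect to a measure of power
growth. -/
theorem exists_measure_riesz_gt_le {n : ℕ} (hn : 0 < n) {α σ Q : ℝ} (hα : 0 < α)
    (hαn : α < n) (hσ : 0 < σ) (hσ1 : σ ≤ 1) (hQ : 0 < Q) :
    ∃ M : ℝ, 0 ≤ M ∧ ∀ (μ : Measure (EuclideanSpace ℝ (Fin n))) [IsFiniteMeasure μ],
      (∀ (x : EuclideanSpace ℝ (Fin n)) (r : ℝ), 0 < r →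
        μ (Metric.ball x r) ≤ ENNReal.ofReal (Q * r ^ (σ * n))) →
      ∀ (h : EuclideanSpace ℝ (Fin n) → ℝ≥0∞) (S : Set (EuclideanSpace ℝ (Fin n))) (τ u : ℝ),
        Measurable h → 0 < τ → 0 ≤ u → volume S = ENNReal.ofReal τ →
        ∫⁻ y in S, h y ^ ((n : ℝ) / α) = ENNReal.ofReal u →
        μ {x | ENNReal.ofReal (M * u ^ (1 / ((n : ℝ) / α))) <
          ∫⁻ y in S, ENNReal.ofReal (‖x - y‖ ^ (α - n)) * h y} ≤ ENNReal.ofReal (τ ^ σ) := by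
  have hpq := holderConjugate_riesz hα hαn
  have hn' : (0 : ℝ) < n := by exact_mod_cast hn
  have hnα : 0 < (n : ℝ) - α := by linarith
  set p := (n : ℝ) / α with hp
  set q := (n : ℝ) / (n - α) with hq
  have hp0 : 0 < p := hpq.pos
  have hq0 : 0 < q := hpq.symm.pos
  have hA := unitBallVolume_pos n
  set b := σ * (n - α) / 2 with hb
  set c := n - σ * α / 2 with hc
  have hb0 : 0 < b := by positivity
  have hbσ : b < σ * n := by rw [hb]; nlinarith
  have hc0 : 0 < c := by rw [hc]; nlinarith
  have hcn : c < n := by rw [hc]; have : 0 < σ * α := by positivity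
                         linarith
  obtain ⟨Cb, hCb0, hCb⟩ := exists_lintegral_ball_rpow_le (n := n) hQ.le hb0 hbσ
  obtain ⟨Cc, hCc0, hCc⟩ := exists_lintegral_ball_rpow_le (n := n) (unitBallVolume_pos n).le hc0 hcn
  have hCc := hCc volume fun x r hr => (volume_ball_eq_unitBallVolume x hr).le
  set D := (Cc + 1) ^ (p / q) with hD
  set M := (D * (Cb + 1) + 1) ^ (1 / p) with hM
  have hMp : M ^ p = D * (Cb + 1) + 1 := by
    rw [hM, ← Real.rpow_mul (by positivity), one_div_mul_cancel hp0.ne', Real.rpow_one]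
  refine ⟨M, by positivity, ?_⟩
  intro μ _ hμ h S τ u hh hτ hu hSτ hSu
  set T : EuclideanSpace ℝ (Fin n) → ℝ≥0∞ :=
    fun x => ∫⁻ y in S, ENNReal.ofReal (‖x - y‖ ^ (α - n)) * h y with hT
  have hTm : Measurable T := measurable_lintegral_riesz _ hh S
  rcases hu.eq_or_lt with rfl | hupos
  · have hT0 : ∀ x, T x = 0 := by
      intro x
      have := ENNReal.lintegral_mul_eq_zero_of_lintegral_rpow_eq_zero (μ := volume.restrict S)
        hp0.le (f := h) (g := fun y => ENNReal.ofReal (‖x - y‖ ^ (α - n))) hh.aemeasurable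
        (by simpa using hSu)
      simpa [hT, mul_comm] using this
    have : {x | ENNReal.ofReal (M * (0 : ℝ) ^ (1 / p)) < T x} = ∅ := by
      ext x; simp [hT0 x]
    change μ {x | ENNReal.ofReal (M * (0 : ℝ) ^ (1 / p)) < T x} ≤ _
    rw [this, measure_empty]
    exact zero_le
  set X := {x | ENNReal.ofReal (M * u ^ (1 / p)) < T x} with hX
  change μ X ≤ _
  have hXm : MeasurableSet X := measurableSet_lt measurable_const hTm
  set ρ := τ ^ (1 / (n : ℝ)) with hρ
  have hρ0 : 0 < ρ := by positivity
  have hTp : ∀ x, T x ^ p ≤ (∫⁻ y in S, ENNReal.ofReal (‖x - y‖ ^ (-b)) * h y ^ p) *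
      ENNReal.ofReal (D * τ ^ (b / n)) := by
    intro x
    have h1 : T x ≤ (∫⁻ y in S, ENNReal.ofReal (‖x - y‖ ^ (-b)) * h y ^ p) ^ (1 / p) *
        (∫⁻ y in S, ENNReal.ofReal (‖x - y‖ ^ (-c))) ^ (1 / q) := by
      have h2 := ENNReal.lintegral_mul_le_Lp_mul_Lq (volume.restrict S) hpq
        (f := fun y => ENNReal.ofReal (‖x - y‖ ^ (-b / p)) * h y)
        (g := fun y => ENNReal.ofReal (‖x - y‖ ^ (-c / q))) (by fun_prop) (by fun_prop)
      have e1 : ∀ y, (ENNReal.ofReal (‖x - y‖ ^ (-b / p)) * h y) ^ p =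
          ENNReal.ofReal (‖x - y‖ ^ (-b)) * h y ^ p := by
        intro y
        rw [ENNReal.mul_rpow_of_nonneg _ _ hp0.le,
          ENNReal.ofReal_rpow_of_nonneg (by positivity) hp0.le, ← Real.rpow_mul (by positivity),
          div_mul_cancel₀ _ hp0.ne']
      have e2 : ∀ y, (ENNReal.ofReal (‖x - y‖ ^ (-c / q))) ^ q = ENNReal.ofReal (‖x - y‖ ^ (-c)) := by
        intro y
        rw [ENNReal.ofReal_rpow_of_nonneg (by positivity) hq0.le, ← Real.rpow_mul (by positivity),
          div_mul_cancel₀ _ hq0.ne']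
      simp only [e1, e2] at h2
      refine le_trans (le_of_eq ?_) h2
      refine lintegral_congr fun y => ?_
      rw [Pi.mul_apply, mul_right_comm, ← ENNReal.ofReal_mul (by positivity)]
      congr 2
      have hexp : α - n = -b / p + -c / q := by
        rw [hb, hc, hp, hq]
        field_simp
        ring
      rcases eq_or_ne ‖x - y‖ 0 with h0 | h0
      · rw [h0, Real.zero_rpow (by linarith),
          Real.zero_rpow (div_ne_zero (neg_ne_zero.2 hb0.ne') hp0.ne'), zero_mul]
      · rw [hexp, Real.rpow_add (lt_of_le_of_ne (norm_nonneg _) h0.symm)]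
    have h3 : ∫⁻ y in S, ENNReal.ofReal (‖x - y‖ ^ (-c)) ≤
        ENNReal.ofReal ((Cc + 1) * τ ^ (σ * α / (2 * n))) := by
      refine (lintegral_rpow_le_of_ball_le hc0.le hρ0 (hCc x ρ hρ0) S).trans ?_
      rw [hSτ, ← ENNReal.ofReal_mul (by positivity), ← ENNReal.ofReal_add (by positivity) (by positivity)]
      refine ENNReal.ofReal_le_ofReal (le_of_eq ?_)
      rw [hρ, ← Real.rpow_mul hτ.le, ← Real.rpow_mul hτ.le]
      nth_rewrite 3 [← Real.rpow_one τ]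
      rw [← Real.rpow_add hτ]
      have e1 : 1 / (n : ℝ) * (n - c) = σ * α / (2 * n) := by rw [hc]; field_simp; ring
      have e2 : 1 / (n : ℝ) * -c + 1 = σ * α / (2 * n) := by rw [hc]; field_simp; ring
      rw [e1, e2]
      ring
    calc T x ^ p ≤ _ := ENNReal.rpow_le_rpow h1 hp0.le
      _ = (∫⁻ y in S, ENNReal.ofReal (‖x - y‖ ^ (-b)) * h y ^ p) *
          (∫⁻ y in S, ENNReal.ofReal (‖x - y‖ ^ (-c))) ^ (p / q) := by
          rw [ENNReal.mul_rpow_of_nonneg _ _ hp0.le, ← ENNReal.rpow_mul, ← ENNReal.rpow_mul,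
            one_div_mul_cancel hp0.ne', ENNReal.rpow_one, one_div_mul_eq_div]
      _ ≤ _ := by
          refine mul_le_mul' le_rfl ((ENNReal.rpow_le_rpow h3 (by positivity)).trans (le_of_eq ?_))
          rw [ENNReal.ofReal_rpow_of_nonneg (by positivity) (by positivity),
            Real.mul_rpow (by positivity) (by positivity), ← Real.rpow_mul hτ.le]
          congr 3
          rw [hp, hq, hb]
          field_simp
  have hX1 : ENNReal.ofReal (M ^ p * u) * μ X ≤ ENNReal.ofReal (D * τ ^ (b / n)) *
      (ENNReal.ofReal u * (ENNReal.ofReal (Cb * ρ ^ (σ * n - b)) + ENNReal.ofReal (ρ ^ (-b)) * μ X)) := by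
    calc ENNReal.ofReal (M ^ p * u) * μ X = ∫⁻ _ in X, ENNReal.ofReal (M * u ^ (1 / p)) ^ p ∂μ := by
          rw [setLIntegral_const, ENNReal.ofReal_rpow_of_nonneg (by positivity) hp0.le,
            Real.mul_rpow (by positivity) (by positivity), ← Real.rpow_mul hu,
            one_div_mul_cancel hp0.ne', Real.rpow_one]
      _ ≤ ∫⁻ x in X, (∫⁻ y in S, ENNReal.ofReal (‖x - y‖ ^ (-b)) * h y ^ p) *
            ENNReal.ofReal (D * τ ^ (b / n)) ∂μ := by
          refine setLIntegral_mono' hXm fun x hx => le_trans ?_ (hTp x)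
          exact ENNReal.rpow_le_rpow (le_of_lt hx) hp0.le
      _ = ENNReal.ofReal (D * τ ^ (b / n)) *
            ∫⁻ x in X, (∫⁻ y in S, ENNReal.ofReal (‖x - y‖ ^ (-b)) * h y ^ p) ∂μ := by
          rw [lintegral_mul_const' _ _ ENNReal.ofReal_ne_top, mul_comm]
      _ = ENNReal.ofReal (D * τ ^ (b / n)) *
            ∫⁻ y in S, (∫⁻ x in X, ENNReal.ofReal (‖x - y‖ ^ (-b)) * h y ^ p ∂μ) := by
          rw [lintegral_lintegral_swap]
          exact ((measurable_riesz_kernel _).mul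
            ((hh.pow_const p).comp measurable_snd)).aemeasurable
      _ ≤ ENNReal.ofReal (D * τ ^ (b / n)) * ∫⁻ y in S, h y ^ p *
            (ENNReal.ofReal (Cb * ρ ^ (σ * n - b)) + ENNReal.ofReal (ρ ^ (-b)) * μ X) := by
          refine mul_le_mul' le_rfl (lintegral_mono fun y => ?_)
          rw [lintegral_mul_const _ (by fun_prop), mul_comm]
          refine mul_le_mul' le_rfl ?_
          simp_rw [norm_sub_rev _ y]
          exact lintegral_rpow_le_of_ball_le hb0.le hρ0 (hCb μ hμ y ρ hρ0) X
      _ = _ := by rw [lintegral_mul_const _ (hh.pow_const p), hSu]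
  by_contra hcon
  push Not at hcon
  set s := (μ X).toReal with hs
  have hseq : μ X = ENNReal.ofReal s := (ENNReal.ofReal_toReal (measure_ne_top μ X)).symm
  have hs0 : 0 ≤ s := ENNReal.toReal_nonneg
  rw [hseq, ENNReal.ofReal_lt_ofReal_iff_of_nonneg (by positivity)] at hcon
  have hspos : 0 < s := lt_trans (by positivity) hcon
  rw [hseq, ← ENNReal.ofReal_mul (by positivity), ← ENNReal.ofReal_mul (by positivity),
    ← ENNReal.ofReal_add (by positivity) (by positivity), ← ENNReal.ofReal_mul hu,
    ← ENNReal.ofReal_mul (by positivity), ENNReal.ofReal_le_ofReal_iff (by positivity), hMp] at hX1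
  have e1 : τ ^ (b / n) * ρ ^ (σ * n - b) = τ ^ σ := by
    rw [hρ, ← Real.rpow_mul hτ.le, ← Real.rpow_add hτ]
    congr 1
    field_simp
    ring
  have e2 : τ ^ (b / n) * ρ ^ (-b) = 1 := by
    rw [hρ, ← Real.rpow_mul hτ.le, ← Real.rpow_add hτ]
    rw [show b / n + 1 / (n : ℝ) * -b = 0 by ring, Real.rpow_zero]
  have e3 : D * τ ^ (b / n) * (u * (Cb * ρ ^ (σ * n - b) + ρ ^ (-b) * s)) =
      D * u * (Cb * τ ^ σ + s) := by
    calc _ = D * u * (Cb * (τ ^ (b / n) * ρ ^ (σ * n - b)) + (τ ^ (b / n) * ρ ^ (-b)) * s) := by ring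
      _ = _ := by rw [e1, e2, one_mul]
  rw [e3] at hX1
  have h4 : D * u * (Cb * τ ^ σ + s) ≤ D * u * ((Cb + 1) * s) := by
    have : Cb * τ ^ σ ≤ Cb * s := by gcongr
    have h5 : Cb * τ ^ σ + s ≤ (Cb + 1) * s := by linarith
    gcongr
  have h5 : 0 < u * s := by positivity
  nlinarith

/-- The exponential inequality for the Riesz potential of a nonnegative function, with respect to a
finite measure of power growth. -/
theorem exists_lintegral_exp_riesz_le {n : ℕ} (hn : 0 < n) {α σ Q : ℝ} (hα : 0 < α)
    (hαn : α < n) (hσ : 0 < σ) (hσ1 : σ ≤ 1) (hQ : 0 < Q) :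
    ∃ C : ℝ, 0 < C ∧ ∀ (μ : Measure (EuclideanSpace ℝ (Fin n))) [IsFiniteMeasure μ],
      (∀ (x : EuclideanSpace ℝ (Fin n)) (r : ℝ), 0 < r →
        μ (Metric.ball x r) ≤ ENNReal.ofReal (Q * r ^ (σ * n))) →
      ∀ (h : EuclideanSpace ℝ (Fin n) → ℝ≥0∞) (F : Set (EuclideanSpace ℝ (Fin n))),
        Measurable h → MeasurableSet F → volume F ≠ ∞ →
        ∫⁻ y in F, h y ^ ((n : ℝ) / α) ≤ 1 →
        (∀ᵐ x ∂μ, ∫⁻ y in F, ENNReal.ofReal (‖x - y‖ ^ (α - n)) * h y ≠ ∞) ∧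
        ∫⁻ x, ENNReal.ofReal (Real.exp (σ / unitBallVolume n *
          (∫⁻ y in F, ENNReal.ofReal (‖x - y‖ ^ (α - n)) * h y).toReal ^ ((n : ℝ) / (n - α)))) ∂μ ≤
        ENNReal.ofReal C * (μ Set.univ + volume F ^ σ) := by
  have hpq := holderConjugate_riesz hα hαn
  obtain ⟨C₁, hC₁, hoff⟩ := exists_setLIntegral_riesz_sdiff_superlevel_le hn hα hαn
  obtain ⟨M, hM, hweak⟩ := exists_measure_riesz_gt_le hn hα hαn hσ hσ1 hQ
  set p := (n : ℝ) / α with hp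
  set q := (n : ℝ) / (n - α) with hq
  have hp0 : 0 < p := hpq.pos
  have hq0 : 0 < q := hpq.symm.pos
  have hA := unitBallVolume_pos n
  set A := unitBallVolume n with hAdef
  set a := A ^ (1 / q) with ha
  have ha0 : 0 < a := by positivity
  have haq : a ^ q = A := by
    rw [ha, ← Real.rpow_mul hA.le, one_div_mul_cancel hq0.ne', Real.rpow_one]
  set N := 1 + C₁ + M / a with hN
  have hN1 : 1 ≤ N := by
    have : 0 ≤ M / a := by positivity
    linarith
  obtain ⟨C', hC'0, hseq⟩ := exists_tsum_exp_le hpq (Real.one_le_rpow hN1 hq0.le) hσ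
  refine ⟨Real.exp σ * C' + 1, by positivity, ?_⟩
  intro μ _ hμ h F hh hF hFf hhF
  set T : EuclideanSpace ℝ (Fin n) → ℝ≥0∞ :=
    fun x => ∫⁻ y in F, ENNReal.ofReal (‖x - y‖ ^ (α - n)) * h y with hT
  have hTm : Measurable T := measurable_lintegral_riesz _ hh F
  rcases eq_or_ne (volume F) 0 with hF0 | hF0
  · have hT0 : ∀ x, T x = 0 := fun x => setLIntegral_measure_zero _ _ hF0
    refine ⟨ae_of_all _ fun x => ?_, ?_⟩
    · change T x ≠ ∞
      rw [hT0]
      exact ENNReal.zero_ne_top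
    · change ∫⁻ x, ENNReal.ofReal (Real.exp (σ / A * (T x).toReal ^ q)) ∂μ ≤ _
      simp only [hT0, ENNReal.toReal_zero, Real.zero_rpow hq0.ne', mul_zero, Real.exp_zero,
        ENNReal.ofReal_one, lintegral_one, hF0, ENNReal.zero_rpow_of_pos hσ, add_zero]
      refine le_mul_of_one_le_left zero_le ?_
      rw [ENNReal.one_le_ofReal]
      have : 0 ≤ Real.exp σ * C' := by positivity
      linarith
  set V := (volume F).toReal with hV
  have hV0 : 0 < V := ENNReal.toReal_pos hF0 hFf
  have hVF : volume F = ENNReal.ofReal V := (ENNReal.ofReal_toReal hFf).symm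
  obtain ⟨S, hS0, hSa, hSm, hSv, hSh⟩ := exists_nested_superlevel hn hh hF hFf
  have hSv' : ∀ k : ℕ, volume (S k) = ENNReal.ofReal (V * Real.exp (-k)) := fun k => by
    rw [hSv, hVF, ENNReal.ofReal_mul hV0.le]
  rw [← hS0] at hSh hhF
  have hoff := hoff h V S hh hV0 hSa hSm hSv' hSh hhF
  set u : ℕ → ℝ := fun k => (∫⁻ y in S k, h y ^ p).toReal with hu
  have hufin : ∀ k, ∫⁻ y in S k, h y ^ p ≤ 1 := fun k =>
    (lintegral_mono_set (hSa (Nat.zero_le k))).trans hhF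
  have hu0 : ∀ k, 0 ≤ u k := fun k => ENNReal.toReal_nonneg
  have hu1 : ∀ k, u k ≤ 1 := fun k =>
    ENNReal.toReal_le_of_le_ofReal zero_le_one (by simpa using hufin k)
  have hueq : ∀ k, ∫⁻ y in S k, h y ^ p = ENNReal.ofReal (u k) := fun k =>
    (ENNReal.ofReal_toReal (ne_top_of_le_ne_top ENNReal.one_ne_top (hufin k))).symm
  have huanti : ∀ {j k}, j ≤ k → u k ≤ u j := fun {j k} hjk =>
    ENNReal.toReal_mono (ne_top_of_le_ne_top ENNReal.one_ne_top (hufin j))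
      (lintegral_mono_set (hSa hjk))
  set G : ℕ → ℝ≥0∞ := fun k =>
    ⨆ x, ∫⁻ y in S 0 \ S k, ENNReal.ofReal (‖x - y‖ ^ (α - n)) * h y with hG
  have hGle : ∀ j k : ℕ, j ≤ k → G k ≤ ENNReal.ofReal (a * ((1 - u j) ^ (1 / p) *
      ((j : ℝ) + 1) ^ (1 / q) + u j ^ (1 / p) * (((k : ℝ) - j + 1) ^ (1 / q) + C₁))) :=
    fun j k hjk => iSup_le (hoff j k hjk)
  have hGfin : ∀ k, G k ≠ ∞ := fun k => ne_top_of_le_ne_top ENNReal.ofReal_ne_top (hGle k k le_rfl)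
  set g : ℕ → ℝ := fun k => (G k).toReal / a + M / a * u k ^ (1 / p) with hg
  have hg0 : ∀ k, 0 ≤ g k := fun k => by have := hu0 k; positivity
  have hag : ∀ k, a * g k = (G k).toReal + M * u k ^ (1 / p) := fun k => by
    rw [hg]; field_simp
  have hgle : ∀ j k : ℕ, j ≤ k → g k ≤ (1 - u j) ^ (1 / p) * ((j : ℝ) + 1) ^ (1 / q) +
      (u j) ^ (1 / p) * (N ^ q * ((k : ℝ) - j + 1)) ^ (1 / q) := by
    intro j k hjk
    have h1u : 0 ≤ 1 - u j := sub_nonneg.2 (hu1 j)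
    have huj := hu0 j
    have hkj : (1 : ℝ) ≤ (k : ℝ) - j + 1 := by
      have : (j : ℝ) ≤ k := by exact_mod_cast hjk
      linarith
    have hkj1 : (1 : ℝ) ≤ ((k : ℝ) - j + 1) ^ (1 / q) := Real.one_le_rpow hkj (by positivity)
    have h1 : (G k).toReal / a ≤ (1 - u j) ^ (1 / p) *
        ((j : ℝ) + 1) ^ (1 / q) + u j ^ (1 / p) * (((k : ℝ) - j + 1) ^ (1 / q) + C₁) := by
      rw [div_le_iff₀' ha0]
      exact ENNReal.toReal_le_of_le_ofReal (by positivity) (hGle j k hjk)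
    have h2 : M / a * u k ^ (1 / p) ≤ M / a * u j ^ (1 / p) := by
      have := hu0 k
      have := huanti hjk
      gcongr
    have h3 : (N ^ q * ((k : ℝ) - j + 1)) ^ (1 / q) = N * ((k : ℝ) - j + 1) ^ (1 / q) := by
      rw [Real.mul_rpow (by positivity) (by linarith), ← Real.rpow_mul (by linarith),
        mul_one_div_cancel hq0.ne', Real.rpow_one]
    have h4 : ((k : ℝ) - j + 1) ^ (1 / q) + C₁ + M / a ≤ N * ((k : ℝ) - j + 1) ^ (1 / q) := by
      have h5 : 0 ≤ C₁ + M / a := by positivity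
      rw [hN]
      nlinarith
    have h5 := mul_le_mul_of_nonneg_left h4 (show 0 ≤ u j ^ (1 / p) by positivity)
    rw [h3]
    calc g k = (G k).toReal / a + M / a * u k ^ (1 / p) := rfl
      _ ≤ _ := add_le_add h1 h2
      _ = (1 - u j) ^ (1 / p) * ((j : ℝ) + 1) ^ (1 / q) +
          u j ^ (1 / p) * (((k : ℝ) - j + 1) ^ (1 / q) + C₁ + M / a) := by ring
      _ ≤ _ := by linarith
  have hsum := hseq g u hg0 hu0 hu1 hgle
  set B : ℕ → Set (EuclideanSpace ℝ (Fin n)) := fun k => {x | ENNReal.ofReal (a * g k) < T x} with hB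
  have hBm : ∀ k, MeasurableSet (B k) := fun k => measurableSet_lt measurable_const hTm
  have hBμ : ∀ k : ℕ, μ (B k) ≤ ENNReal.ofReal (V ^ σ * Real.exp (-σ * k)) := by
    intro k
    have h1 := hweak μ hμ h (S k) (V * Real.exp (-k)) (u k) hh (by positivity) (hu0 k) (hSv' k)
      (hueq k)
    have h2 : (V * Real.exp (-k)) ^ σ = V ^ σ * Real.exp (-σ * k) := by
      rw [Real.mul_rpow hV0.le (Real.exp_pos _).le, ← Real.exp_mul]
      congr 2
      ring
    rw [h2] at h1
    refine (measure_mono fun x hx => ?_).trans h1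
    change ENNReal.ofReal (M * u k ^ (1 / p)) <
      ∫⁻ y in S k, ENNReal.ofReal (‖x - y‖ ^ (α - n)) * h y
    by_contra hcon
    refine absurd (show ENNReal.ofReal (a * g k) < T x from hx) (not_lt.2 ?_)
    have huk := hu0 k
    calc T x = ∫⁻ y in S k ∪ (S 0 \ S k), ENNReal.ofReal (‖x - y‖ ^ (α - n)) * h y := by
          rw [Set.union_sdiff_cancel (hSa (Nat.zero_le k)), hS0]
      _ ≤ _ := lintegral_union_le _ _ _
      _ ≤ ENNReal.ofReal (M * u k ^ (1 / p)) + ENNReal.ofReal (G k).toReal := by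
          refine add_le_add (not_lt.1 hcon) ?_
          rw [ENNReal.ofReal_toReal (hGfin k)]
          exact le_iSup (fun x => ∫⁻ y in S 0 \ S k, ENNReal.ofReal (‖x - y‖ ^ (α - n)) * h y) x
      _ = _ := by
          rw [← ENNReal.ofReal_add (by positivity) ENNReal.toReal_nonneg, hag, add_comm]
  have hBnull : ∀ᵐ x ∂μ, ∃ k, x ∉ B k := by
    rw [ae_iff]
    have hlim : Filter.Tendsto (fun k : ℕ => ENNReal.ofReal (V ^ σ * Real.exp (-σ * k)))
        Filter.atTop (nhds 0) := by
      rw [← ENNReal.ofReal_zero]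
      refine ENNReal.tendsto_ofReal ?_
      rw [← mul_zero (V ^ σ)]
      refine Filter.Tendsto.const_mul _ (Real.tendsto_exp_atBot.comp ?_)
      exact tendsto_natCast_atTop_atTop.const_mul_atTop_of_neg (by linarith)
    refine le_antisymm (ge_of_tendsto' hlim fun k => (measure_mono fun x hx => ?_).trans (hBμ k))
      zero_le
    by_contra hxk
    exact hx ⟨k, hxk⟩
  have hexp : ∀ x k, x ∉ B k → ENNReal.ofReal (Real.exp (σ / A * (T x).toReal ^ q)) ≤
      ENNReal.ofReal (Real.exp (σ * g k ^ q)) := by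
    intro x k hx
    have hgk := hg0 k
    have h1 : (T x).toReal ≤ a * g k :=
      ENNReal.toReal_le_of_le_ofReal (by positivity) (not_lt.1 hx)
    refine ENNReal.ofReal_le_ofReal (Real.exp_le_exp.2 ?_)
    calc σ / A * (T x).toReal ^ q ≤ σ / A * (a * g k) ^ q := by gcongr
      _ = _ := by
        rw [Real.mul_rpow ha0.le hgk, haq]
        field_simp
  refine ⟨?_, ?_⟩
  · filter_upwards [hBnull] with x ⟨k, hk⟩
    exact ne_top_of_le_ne_top ENNReal.ofReal_ne_top (not_lt.1 hk)
  have hpt : ∀ᵐ x ∂μ, ENNReal.ofReal (Real.exp (σ / A * (T x).toReal ^ q)) ≤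
      ENNReal.ofReal (Real.exp (σ * g 0 ^ q)) +
        ∑' k : ℕ, (B k).indicator (fun _ => ENNReal.ofReal (Real.exp (σ * g (k + 1) ^ q))) x := by
    filter_upwards [hBnull] with x hx
    classical
    have h1 := Nat.find_spec hx
    have h2 := fun k => Nat.find_min (m := k) hx
    rcases hk : Nat.find hx with _ | k
    · rw [hk] at h1
      exact (hexp x 0 h1).trans le_self_add
    · rw [hk] at h1 h2
      have hxk : x ∈ B k := by
        by_contra hcon
        exact h2 k (Nat.lt_succ_self k) hcon
      refine (hexp x (k + 1) h1).trans (le_trans ?_ le_add_self)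
      refine le_trans ?_ (ENNReal.le_tsum k)
      rw [Set.indicator_of_mem hxk]
  have hfirst : ENNReal.ofReal (Real.exp (σ * g 0 ^ q)) ≤ ENNReal.ofReal (Real.exp σ * C' + 1) := by
    refine le_trans (le_trans ?_ hsum) (ENNReal.ofReal_le_ofReal ?_)
    · refine le_trans (le_of_eq ?_) (ENNReal.le_tsum 0)
      simp
    · have := Real.one_le_exp hσ.le
      nlinarith
  have hrest : ∑' k : ℕ, ENNReal.ofReal (Real.exp (σ * g (k + 1) ^ q)) * μ (B k) ≤
      ENNReal.ofReal (Real.exp σ * C' + 1) * volume F ^ σ := by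
    calc _ ≤ ∑' k : ℕ, ENNReal.ofReal (V ^ σ * Real.exp σ) *
          ENNReal.ofReal (Real.exp (σ * (g (k + 1) ^ q - (k + 1 : ℕ)))) := by
          refine ENNReal.tsum_le_tsum fun k => (mul_le_mul' le_rfl (hBμ k)).trans (le_of_eq ?_)
          rw [← ENNReal.ofReal_mul (by positivity), ← ENNReal.ofReal_mul (by positivity)]
          congr 1
          rw [mul_left_comm, ← Real.exp_add, mul_assoc, ← Real.exp_add]
          congr 2
          push_cast
          ring
      _ = ENNReal.ofReal (V ^ σ * Real.exp σ) *
          ∑' k : ℕ, ENNReal.ofReal (Real.exp (σ * (g (k + 1) ^ q - (k + 1 : ℕ)))) :=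
          ENNReal.tsum_mul_left
      _ ≤ ENNReal.ofReal (V ^ σ * Real.exp σ) * ENNReal.ofReal C' := by
          refine mul_le_mul' le_rfl (le_trans ?_ hsum)
          exact ENNReal.tsum_comp_le_tsum_of_injective (add_left_injective 1)
            (fun k : ℕ => ENNReal.ofReal (Real.exp (σ * (g k ^ q - k))))
      _ ≤ _ := by
          rw [hVF, ENNReal.ofReal_rpow_of_pos hV0, ← ENNReal.ofReal_mul (by positivity),
            ← ENNReal.ofReal_mul (by positivity)]
          refine ENNReal.ofReal_le_ofReal ?_
          have : 0 ≤ V ^ σ := by positivity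
          nlinarith
  calc _ ≤ ∫⁻ x, (ENNReal.ofReal (Real.exp (σ * g 0 ^ q)) +
        ∑' k : ℕ, (B k).indicator (fun _ => ENNReal.ofReal (Real.exp (σ * g (k + 1) ^ q))) x) ∂μ :=
        lintegral_mono_ae hpt
    _ = ENNReal.ofReal (Real.exp (σ * g 0 ^ q)) * μ Set.univ +
        ∑' k : ℕ, ENNReal.ofReal (Real.exp (σ * g (k + 1) ^ q)) * μ (B k) := by
        rw [lintegral_add_left measurable_const, lintegral_const,
          lintegral_tsum fun k => (measurable_const.indicator (hBm k)).aemeasurable]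
        congr 2
        ext k
        rw [lintegral_indicator_const (hBm k)]
    _ ≤ _ := by
        rw [mul_add]
        exact add_le_add (mul_le_mul' hfirst le_rfl) hrest

theorem lintegral_rpow_enorm_le_one {n : ℕ} {p : ℝ} (hp : 0 < p)
    {f : EuclideanSpace ℝ (Fin n) → ℝ} (hf : eLpNorm f (ENNReal.ofReal p) volume ≤ 1) :
    ∫⁻ y, ‖f y‖ₑ ^ p ≤ 1 := by
  rw [eLpNorm_eq_lintegral_rpow_enorm_toReal (by simpa using hp) ENNReal.ofReal_ne_top,
    ENNReal.toReal_ofReal hp.le] at hf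
  have := ENNReal.rpow_le_rpow hf hp.le
  rwa [← ENNReal.rpow_mul, one_div_mul_cancel hp.ne', ENNReal.rpow_one, ENNReal.one_rpow] at this

/-- The Adams inequality for the Riesz potential on `L^{n/α}(F)`. -/
theorem exists_adamsIntegral_le {n : ℕ} (hn : 0 < n) {α σ Q : ℝ} (hα : 0 < α)
    (hαn : α < n) (hσ : 0 < σ) (hσ1 : σ ≤ 1) (hQ : 0 < Q) :
    ∃ C : ℝ, 0 < C ∧ ∀ ν : Measure (EuclideanSpace ℝ (Fin n)),
      (∀ (x : EuclideanSpace ℝ (Fin n)) (r : ℝ), 0 < r →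
        ν (Metric.ball x r) ≤ ENNReal.ofReal (Q * r ^ (σ * (n : ℝ)))) →
      ∀ E F : Set (EuclideanSpace ℝ (Fin n)), NullMeasurableSet F volume → ν E < ∞ → volume F < ∞ →
        ∀ f : EuclideanSpace ℝ (Fin n) → ℝ, InUnitBallLp ((n : ℝ) / α) F f →
          (∀ᵐ x ∂(ν.restrict E), RieszPotentialConvergesAt α f x) ∧
          adamsIntegral α (σ / unitBallVolume n) ν E f ≤
            ENNReal.ofReal C * (ν E + volume F ^ σ) := by
  obtain ⟨C, hC, H⟩ := exists_lintegral_exp_riesz_le hn hα hαn hσ hσ1 hQ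
  refine ⟨C, hC, ?_⟩
  rintro ν hν E F hF hE hFf f ⟨hfm, hf0, hf1⟩
  have hpq := holderConjugate_riesz hα hαn
  have hA := unitBallVolume_pos n
  obtain ⟨t, hFt, htm, hteq⟩ := hF.exists_measurable_superset_ae_eq
  have htv : volume t = volume F := measure_congr hteq
  have : IsFiniteMeasure (ν.restrict E) := ⟨by simpa using hE⟩
  set φ := hfm.1.mk f with hφ
  have hφm : Measurable φ := hfm.1.stronglyMeasurable_mk.measurable
  have hφf : f =ᵐ[volume] φ := hfm.1.ae_eq_mk
  have hnorm : ∫⁻ y in t, ‖φ y‖ₑ ^ ((n : ℝ) / α) ≤ 1 := by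
    refine (setLIntegral_le_lintegral _ _).trans
      (le_trans (le_of_eq ?_) (lintegral_rpow_enorm_le_one hpq.pos hf1))
    refine lintegral_congr_ae ?_
    filter_upwards [hφf] with y hy
    rw [hy]
  obtain ⟨h1, h2⟩ := H (ν.restrict E) (fun x r hr => (Measure.restrict_apply_le _ _).trans (hν x r hr))
    (fun y => ‖φ y‖ₑ) t hφm.enorm htm (htv ▸ hFf.ne) hnorm
  have hT : ∀ x, ∫⁻ y, ‖‖x - y‖ ^ (α - (n : ℝ)) * f y‖ₑ =
      ∫⁻ y in t, ENNReal.ofReal (‖x - y‖ ^ (α - (n : ℝ))) * ‖φ y‖ₑ := by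
    intro x
    rw [← lintegral_indicator htm]
    refine lintegral_congr_ae ?_
    filter_upwards [hφf, hf0] with y hy hy0
    by_cases hyt : y ∈ t
    · rw [Set.indicator_of_mem hyt, enorm_mul, hy, Real.enorm_of_nonneg (by positivity)]
    · rw [Set.indicator_of_notMem hyt, hy0 fun hyF => hyt (hFt hyF), mul_zero, enorm_zero]
  have hmeas : ∀ x, AEStronglyMeasurable (fun y => ‖x - y‖ ^ (α - (n : ℝ)) * f y) volume := fun x =>
    (by fun_prop : Measurable fun y => ‖x - y‖ ^ (α - (n : ℝ))).aestronglyMeasurable.mul hfm.1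
  refine ⟨?_, ?_⟩
  · filter_upwards [h1] with x hx
    refine ⟨hmeas x, ?_⟩
    rw [HasFiniteIntegral, hT]
    exact hx.lt_top
  · rw [Measure.restrict_apply_univ, htv] at h2
    refine le_trans (lintegral_mono_ae ?_) h2
    filter_upwards [h1] with x hx
    have hle : |rieszPotential α f x| ≤
        (∫⁻ y in t, ENNReal.ofReal (‖x - y‖ ^ (α - (n : ℝ))) * ‖φ y‖ₑ).toReal := by
      rw [← hT] at hx ⊢
      have := enorm_integral_le_lintegral_enorm (μ := volume) fun y => ‖x - y‖ ^ (α - (n : ℝ)) * f y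
      rw [← Real.norm_eq_abs, ← toReal_enorm]
      exact ENNReal.toReal_mono hx this
    have hq := hpq.symm.nonneg
    refine ENNReal.ofReal_le_ofReal (Real.exp_le_exp.2 ?_)
    gcongr

/-- The normalized truncation of `|y - x₀|^{-α}` to the annulus `ε ≤ |y - x₀| < r₀`. -/
noncomputable def annulusExtremal {n : ℕ} (α : ℝ) (x₀ : EuclideanSpace ℝ (Fin n)) (ε r₀ : ℝ) :
    EuclideanSpace ℝ (Fin n) → ℝ :=
  (Metric.ball x₀ r₀ \ Metric.ball x₀ ε).indicator fun y =>
    (n * unitBallVolume n * Real.log (r₀ / ε)) ^ (-(1 / ((n : ℝ) / α))) * ‖x₀ - y‖ ^ (-α)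

theorem measurable_annulusExtremal {n : ℕ} (α : ℝ) (x₀ : EuclideanSpace ℝ (Fin n)) (ε r₀ : ℝ) :
    Measurable (annulusExtremal α x₀ ε r₀) :=
  Measurable.indicator (by fun_prop) (measurableSet_ball.diff measurableSet_ball)

theorem annulusExtremal_nonneg {n : ℕ} (α : ℝ) (x₀ : EuclideanSpace ℝ (Fin n)) {ε r₀ : ℝ}
    (hε : 0 < ε) (hεr : ε < r₀) (y : EuclideanSpace ℝ (Fin n)) : 0 ≤ annulusExtremal α x₀ ε r₀ y := by
  have := unitBallVolume_pos n
  have := Real.log_pos ((one_lt_div hε).2 hεr)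
  exact Set.indicator_nonneg (fun _ _ => by positivity) y

theorem mem_annulus_iff {n : ℕ} {x₀ y : EuclideanSpace ℝ (Fin n)} {ε r₀ : ℝ} :
    y ∈ Metric.ball x₀ r₀ \ Metric.ball x₀ ε ↔ ε ≤ ‖x₀ - y‖ ∧ ‖x₀ - y‖ < r₀ := by
  rw [Set.mem_sdiff, Metric.mem_ball, Metric.mem_ball, dist_comm, dist_eq_norm, not_lt, and_comm]

theorem eLpNorm_annulusExtremal {n : ℕ} (hn : 0 < n) {α : ℝ} (hα : 0 < α)
    (x₀ : EuclideanSpace ℝ (Fin n)) {ε r₀ : ℝ} (hε : 0 < ε) (hεr : ε < r₀) :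
    eLpNorm (annulusExtremal α x₀ ε r₀) (ENNReal.ofReal ((n : ℝ) / α)) volume = 1 := by
  have hn' : (0 : ℝ) < n := by exact_mod_cast hn
  have hA := unitBallVolume_pos n
  have hlog := Real.log_pos ((one_lt_div hε).2 hεr)
  have hp0 : 0 < (n : ℝ) / α := by positivity
  have hms : MeasurableSet (Metric.ball x₀ r₀ \ Metric.ball x₀ ε) :=
    measurableSet_ball.diff measurableSet_ball
  set Λ := n * unitBallVolume n * Real.log (r₀ / ε) with hΛ
  have hΛ0 : 0 < Λ := by positivity
  rw [eLpNorm_eq_lintegral_rpow_enorm_toReal (by simpa using hp0) ENNReal.ofReal_ne_top,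
    ENNReal.toReal_ofReal hp0.le]
  have h1 : ∀ y, ‖annulusExtremal α x₀ ε r₀ y‖ₑ ^ ((n : ℝ) / α) =
      (Metric.ball x₀ r₀ \ Metric.ball x₀ ε).indicator
        (fun y => ENNReal.ofReal Λ⁻¹ * ENNReal.ofReal (‖x₀ - y‖ ^ (-(n : ℝ)))) y := by
    intro y
    unfold annulusExtremal
    by_cases hy : y ∈ Metric.ball x₀ r₀ \ Metric.ball x₀ ε
    · rw [Set.indicator_of_mem hy, Set.indicator_of_mem hy, ← hΛ,
        Real.enorm_of_nonneg (by positivity), ENNReal.ofReal_rpow_of_nonneg (by positivity) hp0.le,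
        ← ENNReal.ofReal_mul (by positivity), Real.mul_rpow (by positivity) (by positivity),
        ← Real.rpow_mul hΛ0.le, ← Real.rpow_mul (by positivity)]
      have e1 : -(1 / ((n : ℝ) / α)) * (n / α) = -1 := by field_simp
      have e2 : -α * ((n : ℝ) / α) = -n := by field_simp
      rw [e1, e2, Real.rpow_neg_one]
    · rw [Set.indicator_of_notMem hy, Set.indicator_of_notMem hy, enorm_zero,
        ENNReal.zero_rpow_of_pos hp0]
  simp only [h1]
  rw [lintegral_indicator hms, lintegral_const_mul _ (by fun_prop),
    lintegral_annulus_rpow_neg hn x₀ hε hεr.le, ← hΛ, ← ENNReal.ofReal_mul (by positivity),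
    inv_mul_cancel₀ hΛ0.ne', ENNReal.ofReal_one, ENNReal.one_rpow]

theorem le_rieszPotential_annulusExtremal {n : ℕ} (hn : 0 < n) {α : ℝ} (hα : 0 < α) (hαn : α < n)
    (x₀ : EuclideanSpace ℝ (Fin n)) {ε r₀ δ : ℝ} (hε : 0 < ε) (hεr : ε < r₀) (hδ : 0 < δ)
    (hδ1 : δ < 1) {x : EuclideanSpace ℝ (Fin n)} (hx : x ∈ Metric.ball x₀ (δ * ε)) :
    (1 + δ) ^ (α - n) * (n * unitBallVolume n * Real.log (r₀ / ε)) ^ (1 / ((n : ℝ) / (n - α))) ≤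
      rieszPotential α (annulusExtremal α x₀ ε r₀) x := by
  have hpq := holderConjugate_riesz hα hαn
  have hn' : (0 : ℝ) < n := by exact_mod_cast hn
  have hA := unitBallVolume_pos n
  have hlog := Real.log_pos ((one_lt_div hε).2 hεr)
  have hms : MeasurableSet (Metric.ball x₀ r₀ \ Metric.ball x₀ ε) :=
    measurableSet_ball.diff measurableSet_ball
  have hφ0 := annulusExtremal_nonneg α x₀ hε hεr
  have hφdef : ∀ y ∈ Metric.ball x₀ r₀ \ Metric.ball x₀ ε, annulusExtremal α x₀ ε r₀ y =
      (n * unitBallVolume n * Real.log (r₀ / ε)) ^ (-(1 / ((n : ℝ) / α))) * ‖x₀ - y‖ ^ (-α) :=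
    fun y hy => Set.indicator_of_mem hy _
  have hφout : ∀ y ∉ Metric.ball x₀ r₀ \ Metric.ball x₀ ε, annulusExtremal α x₀ ε r₀ y = 0 :=
    fun y hy => Set.indicator_of_notMem hy _
  have hφm := measurable_annulusExtremal α x₀ ε r₀
  set φ := annulusExtremal α x₀ ε r₀
  set Λ := n * unitBallVolume n * Real.log (r₀ / ε) with hΛ
  have hΛ0 : 0 < Λ := by positivity
  have hxx : ‖x - x₀‖ < δ * ε := by rwa [Metric.mem_ball, dist_eq_norm] at hx
  have hup : ∀ y ∈ Metric.ball x₀ r₀ \ Metric.ball x₀ ε, ‖x - y‖ ≤ (1 + δ) * ‖x₀ - y‖ := by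
    intro y hy
    have h1 := (mem_annulus_iff.1 hy).1
    have h2 := norm_add_le (x - x₀) (x₀ - y)
    rw [sub_add_sub_cancel] at h2
    nlinarith
  have hlow : ∀ y ∈ Metric.ball x₀ r₀ \ Metric.ball x₀ ε, (1 - δ) * ε ≤ ‖x - y‖ := by
    intro y hy
    have h1 := (mem_annulus_iff.1 hy).1
    have h2 := norm_add_le (x₀ - x) (x - y)
    rw [sub_add_sub_cancel, norm_sub_rev x₀ x] at h2
    linarith
  have hδε : 0 < (1 - δ) * ε := mul_pos (by linarith) hε
  have hnn : ∀ y, 0 ≤ ‖x - y‖ ^ (α - (n : ℝ)) * φ y := fun y => mul_nonneg (by positivity) (hφ0 y)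
  rw [rieszPotential, integral_eq_lintegral_of_nonneg_ae (ae_of_all _ hnn)
    (by fun_prop : Measurable fun y => ‖x - y‖ ^ (α - (n : ℝ)) * φ y).aestronglyMeasurable]
  have hsupp : ∫⁻ y, ENNReal.ofReal (‖x - y‖ ^ (α - (n : ℝ)) * φ y) =
      ∫⁻ y in Metric.ball x₀ r₀ \ Metric.ball x₀ ε,
        ENNReal.ofReal (‖x - y‖ ^ (α - (n : ℝ)) * φ y) := by
    rw [← lintegral_indicator hms]
    refine lintegral_congr fun y => ?_
    by_cases hy : y ∈ Metric.ball x₀ r₀ \ Metric.ball x₀ ε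
    · rw [Set.indicator_of_mem hy]
    · rw [Set.indicator_of_notMem hy, hφout y hy, mul_zero, ENNReal.ofReal_zero]
  rw [hsupp]
  have hfin : ∫⁻ y in Metric.ball x₀ r₀ \ Metric.ball x₀ ε,
      ENNReal.ofReal (‖x - y‖ ^ (α - (n : ℝ)) * φ y) ≠ ∞ := by
    have hle : ∫⁻ y in Metric.ball x₀ r₀ \ Metric.ball x₀ ε,
        ENNReal.ofReal (‖x - y‖ ^ (α - (n : ℝ)) * φ y) ≤
        ∫⁻ y in Metric.ball x₀ r₀ \ Metric.ball x₀ ε,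
          ENNReal.ofReal (((1 - δ) * ε) ^ (α - (n : ℝ)) * (Λ ^ (-(1 / ((n : ℝ) / α))) * ε ^ (-α))) := by
      refine setLIntegral_mono measurable_const fun y hy => ENNReal.ofReal_le_ofReal ?_
      rw [hφdef y hy]
      have h1 := Real.rpow_le_rpow_of_nonpos hδε (hlow y hy) (show α - n ≤ 0 by linarith)
      have h2 := Real.rpow_le_rpow_of_nonpos hε (mem_annulus_iff.1 hy).1 (show -α ≤ 0 by linarith)
      gcongr
    refine ne_top_of_le_ne_top ?_ hle
    rw [setLIntegral_const]
    exact ENNReal.mul_ne_top ENNReal.ofReal_ne_top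
      (measure_ne_top_of_subset Set.sdiff_subset measure_ball_lt_top.ne)
  rw [← ENNReal.ofReal_le_iff_le_toReal hfin]
  calc ENNReal.ofReal ((1 + δ) ^ (α - n) * Λ ^ (1 / ((n : ℝ) / (n - α))))
      = ENNReal.ofReal ((1 + δ) ^ (α - n) * Λ ^ (-(1 / ((n : ℝ) / α)))) * ENNReal.ofReal Λ := by
        rw [← ENNReal.ofReal_mul (by positivity), mul_assoc]
        congr 2
        nth_rewrite 3 [← Real.rpow_one Λ]
        rw [← Real.rpow_add hΛ0]
        congr 1
        have := hpq.inv_add_inv_eq_one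
        rw [one_div, one_div]
        linarith
    _ = ∫⁻ y in Metric.ball x₀ r₀ \ Metric.ball x₀ ε,
          ENNReal.ofReal ((1 + δ) ^ (α - n) * Λ ^ (-(1 / ((n : ℝ) / α)))) *
            ENNReal.ofReal (‖x₀ - y‖ ^ (-(n : ℝ))) := by
        rw [lintegral_const_mul _ (by fun_prop), lintegral_annulus_rpow_neg hn x₀ hε hεr.le]
    _ ≤ _ := by
        refine setLIntegral_mono' hms fun y hy => ?_
        rw [← ENNReal.ofReal_mul (by positivity)]
        refine ENNReal.ofReal_le_ofReal ?_
        rw [hφdef y hy]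
        have h0 : 0 < ‖x₀ - y‖ := lt_of_lt_of_le hε (mem_annulus_iff.1 hy).1
        have h1 := Real.rpow_le_rpow_of_nonpos (lt_of_lt_of_le hδε (hlow y hy)) (hup y hy)
          (show α - n ≤ 0 by linarith)
        rw [Real.mul_rpow (by positivity) h0.le] at h1
        have h2 : ‖x₀ - y‖ ^ (-(n : ℝ)) = ‖x₀ - y‖ ^ (α - n) * ‖x₀ - y‖ ^ (-α) := by
          rw [← Real.rpow_add h0]
          congr 1
          ring
        calc _ = ((1 + δ) ^ (α - n) * ‖x₀ - y‖ ^ (α - n)) *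
              (Λ ^ (-(1 / ((n : ℝ) / α))) * ‖x₀ - y‖ ^ (-α)) := by rw [h2]; ring
          _ ≤ _ := by gcongr

/-- Sharpness of the exponential constant in the Adams inequality. -/
theorem exists_lt_adamsIntegral {n : ℕ} (hn : 0 < n) {α σ : ℝ} (hα : 0 < α) (hαn : α < n)
    (hσ : 0 < σ) {ν : Measure (EuclideanSpace ℝ (Fin n))} {E F : Set (EuclideanSpace ℝ (Fin n))}
    (hF : NullMeasurableSet F volume) {x₀ : EuclideanSpace ℝ (Fin n)} {r₀ c₁ : ℝ} (hr₀ : 0 < r₀)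
    (hc₁ : 0 < c₁) (hBF : volume (Metric.ball x₀ r₀ ∩ F) = volume (Metric.ball x₀ r₀))
    (hνE : ∀ r : ℝ, 0 < r → r ≤ r₀ →
      ENNReal.ofReal (c₁ * r ^ (σ * (n : ℝ))) ≤ ν (Metric.ball x₀ r ∩ E))
    {γ : ℝ} (hγ : σ / unitBallVolume n < γ) (K : ℝ) :
    ∃ f : EuclideanSpace ℝ (Fin n) → ℝ, InUnitBallLp ((n : ℝ) / α) F f ∧
      ENNReal.ofReal K < adamsIntegral α γ ν E f := by
  have hpq := holderConjugate_riesz hα hαn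
  have hn' : (0 : ℝ) < n := by exact_mod_cast hn
  have hA := unitBallVolume_pos n
  have hγ0 : 0 < γ := lt_trans (by positivity) hγ
  obtain ⟨δ, hδ0, hδ1, hδ⟩ : ∃ δ : ℝ, 0 < δ ∧ δ < 1 ∧
      σ < γ * unitBallVolume n * (1 + δ) ^ (-(n : ℝ)) := by
    have hcont : ContinuousAt (fun δ : ℝ => γ * unitBallVolume n * (1 + δ) ^ (-(n : ℝ))) 0 := by
      refine continuousAt_const.mul (ContinuousAt.rpow_const (by fun_prop) (Or.inl (by norm_num)))
    have h0 : σ < γ * unitBallVolume n * (1 + 0) ^ (-(n : ℝ)) := by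
      rw [add_zero, Real.one_rpow, mul_one]
      exact (div_lt_iff₀ hA).1 hγ
    have h1 : ∀ᶠ δ in nhdsWithin (0 : ℝ) (Set.Ioi 0),
        σ < γ * unitBallVolume n * (1 + δ) ^ (-(n : ℝ)) :=
      (hcont.eventually (lt_mem_nhds h0)).filter_mono nhdsWithin_le_nhds
    have h2 : ∀ᶠ δ in nhdsWithin (0 : ℝ) (Set.Ioi 0), δ ∈ Set.Ioo (0 : ℝ) 1 :=
      Ioo_mem_nhdsGT one_pos
    obtain ⟨δ, h3, h4⟩ := (h1.and h2).exists
    exact ⟨δ, h4.1, h4.2, h3⟩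
  set β := γ * unitBallVolume n * (1 + δ) ^ (-(n : ℝ)) with hβ
  obtain ⟨s, hs1, hs⟩ : ∃ s : ℝ, 1 < s ∧
      max K 0 < c₁ * (δ * r₀) ^ (σ * (n : ℝ)) * s ^ (n * (β - σ)) := by
    have hlim : Filter.Tendsto (fun s : ℝ => c₁ * (δ * r₀) ^ (σ * (n : ℝ)) * s ^ (n * (β - σ)))
        Filter.atTop Filter.atTop :=
      (tendsto_rpow_atTop (mul_pos hn' (by linarith))).const_mul_atTop (by positivity)
    obtain ⟨s, h1, h2⟩ := ((Filter.eventually_gt_atTop 1).and (hlim.eventually_gt_atTop _)).exists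
    exact ⟨s, h1, h2⟩
  have hs0 : 0 < s := by linarith
  set ε := r₀ / s with hε_def
  have hε : 0 < ε := by positivity
  have hεr : ε < r₀ := div_lt_self hr₀ hs1
  have hrs : r₀ / ε = s := by rw [hε_def]; field_simp
  have hnorm := eLpNorm_annulusExtremal hn hα x₀ hε hεr
  refine ⟨annulusExtremal α x₀ ε r₀,
    ⟨⟨(measurable_annulusExtremal α x₀ ε r₀).aestronglyMeasurable, by rw [hnorm]; simp⟩, ?_,
      hnorm.le⟩, ?_⟩
  · have hnull : volume (Metric.ball x₀ r₀ \ F) = 0 := by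
      have h1 := measure_inter_add_sdiff₀ (μ := volume) (Metric.ball x₀ r₀) hF
      rw [hBF] at h1
      rw [← add_zero (volume (Metric.ball x₀ r₀)), add_assoc, zero_add] at h1
      exact (ENNReal.add_right_inj measure_ball_lt_top.ne).1 h1
    rw [ae_iff]
    refine measure_mono_null (fun y hy => ?_) hnull
    rw [Set.mem_ofPred_eq, Classical.not_imp] at hy
    refine ⟨?_, hy.1⟩
    by_contra hcon
    exact hy.2 (Set.indicator_of_notMem (fun h => hcon h.1) _)
  · set Λ := n * unitBallVolume n * Real.log (r₀ / ε) with hΛ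
    have hlog := Real.log_pos ((one_lt_div hε).2 hεr)
    have hΛ0 : 0 < Λ := by positivity
    have hq0 := hpq.symm.pos
    have hpt : ∀ x ∈ Metric.ball x₀ (δ * ε), ENNReal.ofReal (s ^ (n * β)) ≤
        ENNReal.ofReal (Real.exp (γ * |rieszPotential α (annulusExtremal α x₀ ε r₀) x| ^
          ((n : ℝ) / ((n : ℝ) - α)))) := by
      intro x hx
      have h1 := le_rieszPotential_annulusExtremal hn hα hαn x₀ hε hεr hδ0 hδ1 hx
      have h2 := Real.rpow_le_rpow (by positivity) (h1.trans (le_abs_self _)) hq0.le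
      rw [Real.mul_rpow (by positivity) (by positivity), ← Real.rpow_mul (by positivity),
        ← Real.rpow_mul hΛ0.le, one_div_mul_cancel hq0.ne', Real.rpow_one] at h2
      have e1 : (α - n) * ((n : ℝ) / (n - α)) = -n := by
        have : (n : ℝ) - α ≠ 0 := by linarith
        field_simp
        ring
      rw [e1] at h2
      refine ENNReal.ofReal_le_ofReal ?_
      rw [Real.rpow_def_of_pos hs0]
      refine Real.exp_le_exp.2 (le_trans (le_of_eq ?_) (mul_le_mul_of_nonneg_left h2 hγ0.le))
      rw [hΛ, hrs, hβ]
      ring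
    have hδε : δ * ε ≤ r₀ := by nlinarith
    calc ENNReal.ofReal K < ENNReal.ofReal (s ^ (n * β) * (c₁ * (δ * ε) ^ (σ * (n : ℝ)))) := by
          have e1 : s ^ (n * β) * (c₁ * (δ * ε) ^ (σ * (n : ℝ))) =
              c₁ * (δ * r₀) ^ (σ * (n : ℝ)) * s ^ (n * (β - σ)) := by
            rw [hε_def, ← mul_div_assoc, Real.div_rpow (by positivity) hs0.le, mul_sub,
              Real.rpow_sub hs0, mul_comm (n : ℝ) σ]
            ring
          rw [e1]
          exact (ENNReal.ofReal_le_ofReal (le_max_left K 0)).trans_lt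
            ((ENNReal.ofReal_lt_ofReal_iff_of_nonneg (le_max_right K 0)).2 hs)
      _ = ENNReal.ofReal (s ^ (n * β)) * ENNReal.ofReal (c₁ * (δ * ε) ^ (σ * (n : ℝ))) :=
          ENNReal.ofReal_mul (by positivity)
      _ ≤ ENNReal.ofReal (s ^ (n * β)) * (ν.restrict E) (Metric.ball x₀ (δ * ε)) := by
          rw [Measure.restrict_apply measurableSet_ball]
          exact mul_le_mul' le_rfl (hνE _ (by positivity) hδε)
      _ = ∫⁻ _ in Metric.ball x₀ (δ * ε), ENNReal.ofReal (s ^ (n * β)) ∂(ν.restrict E) := by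
          rw [setLIntegral_const]
      _ ≤ ∫⁻ x in Metric.ball x₀ (δ * ε), ENNReal.ofReal (Real.exp (γ *
            |rieszPotential α (annulusExtremal α x₀ ε r₀) x| ^ ((n : ℝ) / ((n : ℝ) - α))))
            ∂(ν.restrict E) := setLIntegral_mono' measurableSet_ball hpt
      _ ≤ _ := setLIntegral_le_lintegral _ _

theorem corollary3 (n : ℕ) (α σ Q : ℝ) (hα : 0 < α) (hαn : α < (n : ℝ))
    (hσ : 0 < σ) (hσ1 : σ ≤ 1) (hQ : 0 < Q) :
    ∃ C : ℝ, 0 < C ∧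
      ∀ ν : Measure (EuclideanSpace ℝ (Fin n)),
        (∀ (x : EuclideanSpace ℝ (Fin n)) (r : ℝ), 0 < r →
          ν (Metric.ball x r) ≤ ENNReal.ofReal (Q * r ^ (σ * (n : ℝ)))) →
        ∀ E F : Set (EuclideanSpace ℝ (Fin n)),
          NullMeasurableSet E ν → NullMeasurableSet F volume → ν E < ∞ → volume F < ∞ →
          -- the inequality
          (∀ f : EuclideanSpace ℝ (Fin n) → ℝ, InUnitBallLp ((n : ℝ) / α) F f →
            (∀ᵐ x ∂(ν.restrict E), RieszPotentialConvergesAt α f x) ∧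
            adamsIntegral α (σ / unitBallVolume n) ν E f
              ≤ ENNReal.ofReal C * (ν E + volume F ^ σ)) ∧
          -- sharpness of the exponential constant
          (∀ (x₀ : EuclideanSpace ℝ (Fin n)) (r₀ c₁ : ℝ), 0 < r₀ → 0 < c₁ →
            volume (Metric.ball x₀ r₀ ∩ F) = volume (Metric.ball x₀ r₀) →
            (∀ r : ℝ, 0 < r → r ≤ r₀ →
              ENNReal.ofReal (c₁ * r ^ (σ * (n : ℝ))) ≤ ν (Metric.ball x₀ r ∩ E)) →
            ∀ γ : ℝ, σ / unitBallVolume n < γ → ∀ K : ℝ,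
              ∃ f : EuclideanSpace ℝ (Fin n) → ℝ, InUnitBallLp ((n : ℝ) / α) F f ∧
                ENNReal.ofReal K < adamsIntegral α γ ν E f) := by
  have hn : 0 < n := by
    have : (0 : ℝ) < n := hα.trans hαn
    exact_mod_cast this
  obtain ⟨C, hC, H⟩ := exists_adamsIntegral_le hn hα hαn hσ hσ1 hQ
  refine ⟨C, hC, fun ν hν E F _ hF hE hFf => ⟨H ν hν E F hF hE hFf, ?_⟩⟩
  intro x₀ r₀ c₁ hr₀ hc₁ hBF hνE γ hγ K
  exact exists_lt_adamsIntegral hn hα hαn hσ hF hr₀ hc₁ hBF hνE hγ K
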